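/- Let $B_n$ be a *heavy binary tree*: take a balanced binary tree on $n$ vertices (a rooted tree in which every vertex has at most two children, every level except possibly the last is full, and exactly $\lceil n/2\rceil$ vertices are leaves) and add an edge between every pair of leaves. A *leaf* of $B_n$ is a leaf of the original tree. Let $s$ be the source vertex. All protocols run in synchronous rounds $t=0,1,2,\dots$. - **push.** In round $0$, $s$ is informed. In each round $t\ge1$ every vertex informed in an earlier round samples an independent, uniformly random neighbour, which becomes informed. $T_{\rm push}$ is the number of rounds until all vertices are informed. - **visit-exchange.** A set $A$ of agents perform independent simple random walks on $B_n$, each started from the stationary distribution $\deg(v)/(2|E|)$. In round $0$, $s$ and all agents on $s$ are informed. In each round $t\ge 1$ all agents make one step; then every vertex visited by an agent informed in an earlier round becomes informed, and every agent located on an informed vertex (including one informed in this round) becomes informed. $T_{\rm visitx}$ is the number of rounds until all vertices are informed. - **meet-exchange.** The agents walk in the same way. In round $0$ all agents on $s$ are informed; if there is none, all agents on $s$ in the first round in which some agent visits $s$ become informed. After that $s$ informs no more agents. In each round $t\ge1$, every agent that is on the same vertex as an agent informed in an earlier round becomes informed. $T_{\rm meetx}$ is the number of rounds until all agents are informed.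 The broadcast times are $\infty$ if the event in question never happens. The number of agents is linear: $\alpha n\le |A|\le \beta n$ for constants $0<\alpha\le\beta$. Then: (a) For every $\lambda>0$ there are $C>0$ and $n_0$ such that for all $n\ge n_0$, every such $B_n$ and every source vertex $s$, $\Pr[T_{\rm push}\le C\log n]\ge 1-n^{-\lambda}$. (b) For all $0<\alpha\le\beta$ there are $c>0$ and $n_0$ such that for all $n\ge n_0$, every such $B_n$, every source vertex $s$ and every number of agents $\alpha n\le|A|\le\beta n$, $\mathbb{E}[T_{\rm visitx}]\ge c\,n$. (c) For all $0<\alpha\le\beta$ and $\lambda>0$ there are $C>0$ and $n_0$ such that for all $n\ge n_0$, every such $B_n$, every source $s$ that is a leaf and every number of agents $\alpha n\le|A|\le\beta n$, $\Pr[T_{\rm meetx}\le C\log n]\ge 1-n^{-\lambda}$. -/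

import Mathlib

open MeasureTheory ProbabilityTheory
open scoped ENNReal

namespace RumorSpreading

/-! ### The heavy binary tree -/

/-- A balanced binary tree on the `n` vertices `Fin n`, rooted at `root` and given by its parent
function (the value of `parent` at the root is irrelevant). The laws of `depth` make it the number
of edges to the root; in particular every vertex is joined to the root through its ancestors.
Every vertex has at most two children, every level of the tree except possibly the last one is
full (`balanced`), and exactly `⌈n / 2⌉` vertices are leaves. -/
structure BalancedBinaryTree (n : ℕ) where
  root : Fin n
  parent : Fin n → Fin n
  depth : Fin n → ℕ
  depth_root : depth root = 0
  depth_eq : ∀ v, v ≠ root → depth v = depth (parent v) + 1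
  card_children_le : ∀ u, {v | v ≠ root ∧ parent v = u}.ncard ≤ 2
  balanced : ∀ u, {v | v ≠ root ∧ parent v = u}.ncard < 2 → ∀ w, depth w ≤ depth u + 1
  card_leaves : {u | ∀ v, ¬ (v ≠ root ∧ parent v = u)}.ncard = (n + 1) / 2

namespace BalancedBinaryTree

variable {n : ℕ}

/-- `v` is a child of `u`. -/
def IsChild (T : BalancedBinaryTree n) (u v : Fin n) : Prop := v ≠ T.root ∧ T.parent v = u

/-- A leaf is a vertex without children. -/
def IsLeaf (T : BalancedBinaryTree n) (u : Fin n) : Prop := ∀ v, ¬ T.IsChild u v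

/-- The heavy binary tree: the edges of the tree (a vertex and its parent), together with an edge
between every pair of distinct leaves. -/
def heavyGraph (T : BalancedBinaryTree n) : SimpleGraph (Fin n) :=
  SimpleGraph.fromRel fun u v => T.IsChild u v ∨ (T.IsLeaf u ∧ T.IsLeaf v)

end BalancedBinaryTree

/-! ### Random neighbours and random walks -/

/-- The probability that a uniformly random neighbour of `u` is `v`. -/
noncomputable def stepProb {V : Type*} (G : SimpleGraph V) (u v : V) : ℝ :=
  open Classical in if G.Adj u v then 1 / ((G.neighborSet u).ncard : ℝ) else 0

/-- The stationary distribution of the simple random walk: `deg v / (2 |E|)`. -/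
noncomputable def stationaryProb {V : Type*} (G : SimpleGraph V) (v : V) : ℝ :=
  (G.neighborSet v).ncard / (2 * G.edgeSet.ncard)

/-- The random choices of `push`: `N t u` is the neighbour that `u` samples in round `t` (used only
if `u` is informed by then). The choices are independent over all rounds and vertices, and each is
uniform among the neighbours. -/
structure IsNeighborSampling {V Ω : Type*} [MeasurableSpace V] [MeasurableSpace Ω]
    (G : SimpleGraph V) (μ : Measure Ω) (N : ℕ → V → Ω → V) : Prop where
  measurable : ∀ t u, Measurable (N t u)
  indep : iIndepFun (fun (p : ℕ × V) ω => N p.1 p.2 ω) μ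
  law : ∀ t u v, μ.real {ω | N t u ω = v} = stepProb G u v

/-- The walks of the agents `g : A`: `X g t` is the position of `g` in round `t`. The walks of
different agents are independent, and each one is a simple random walk (uniform step to a
neighbour) started from the stationary distribution, which is expressed by its
finite-dimensional laws. -/
structure IsStationaryWalks {V Ω A : Type*} [MeasurableSpace V] [MeasurableSpace Ω]
    (G : SimpleGraph V) (μ : Measure Ω) (X : A → ℕ → Ω → V) : Prop where
  measurable : ∀ g t, Measurable (X g t)
  indep : iIndepFun (fun (g : A) ω (t : ℕ) => X g t ω) μ
  law : ∀ (g : A) (t : ℕ) (x : ℕ → V),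
    μ.real {ω | ∀ i ≤ t, X g i ω = x i} =
      stationaryProb G (x 0) * ∏ i ∈ Finset.range t, stepProb G (x i) (x (i + 1))

/-! ### The protocols, for a given realization of the random choices -/

section Protocols

variable {V A : Type*}

/-- The vertices informed after round `t` of `push`. -/
def pushInformed (s : V) (N : ℕ → V → V) : ℕ → Set V
  | 0 => {s}
  | t + 1 => pushInformed s N t ∪ {v | ∃ u ∈ pushInformed s N t, N (t + 1) u = v}

/-- One round of `visit-exchange`, with agents at positions `x` after the step: vertices visited by
previously informed agents become informed, then all agents on informed vertices do. -/
def visitStep (x : A → V) (p : Set V × Set A) : Set V × Set A :=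
  (p.1 ∪ {v | ∃ g ∈ p.2, x g = v},
    p.2 ∪ {g | x g ∈ p.1 ∪ {v | ∃ h ∈ p.2, x h = v}})

/-- The vertices and the agents informed after round `t` of `visit-exchange`. -/
def visitInformed (s : V) (X : A → ℕ → V) : ℕ → Set V × Set A
  | 0 => ({s}, {g | X g 0 = s})
  | t + 1 => visitStep (fun g => X g (t + 1)) (visitInformed s X t)

/-- The agents informed after round `t` of `meet-exchange`: an agent becomes informed when it meets
a previously informed agent, or when it visits the source while no agent was informed before. -/
def meetInformed (s : V) (X : A → ℕ → V) : ℕ → Set A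
  | 0 => {g | X g 0 = s}
  | t + 1 => meetInformed s X t ∪
      {g | ∃ h ∈ meetInformed s X t, X g (t + 1) = X h (t + 1)} ∪
      {g | meetInformed s X t = ∅ ∧ X g (t + 1) = s}

/-- The first round after which everything is informed, and `⊤` if there is none. -/
noncomputable def firstFull {S : Type*} (I : ℕ → Set S) : ℕ∞ :=
  ⨅ (t : ℕ) (_ : I t = Set.univ), (t : ℕ∞)

/-- Broadcast time of `push`: the number of rounds before all vertices are informed. -/
noncomputable def Tpush (s : V) (N : ℕ → V → V) : ℕ∞ :=
  firstFull (pushInformed s N)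

/-- Broadcast time of `visit-exchange`: the number of rounds before all vertices are informed. -/
noncomputable def Tvisitx (s : V) (X : A → ℕ → V) : ℕ∞ :=
  firstFull fun t => (visitInformed s X t).1

/-- Broadcast time of `meet-exchange`: the number of rounds before all agents are informed. -/
noncomputable def Tmeetx (s : V) (X : A → ℕ → V) : ℕ∞ :=
  firstFull (meetInformed s X)

end Protocols

end RumorSpreading

open RumorSpreading

namespace RumorSpreading

/-! Let `K` be the number of leaves, about `n / 2`. A leaf has degree exactly `K` and an internal
vertex degree at most 3, so the leaves carry almost all of the degree sum and an internal vertex has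
stationary mass at most `12 / n ^ 2`. This separates the protocols.

For visit-exchange, fix an internal vertex other than the source. Linearly many agents visit it at
rate `O(1 / n)` per round, so a union bound over agents and rounds leaves it unvisited for order `n`
rounds with probability at least 1/2 (`visitx_lower_bound`).

Both upper bounds use one device, `IsDriven.measureReal_le_of_contracting`: a nonnegative potential
that contracts in expectation by a fixed factor `ρ < 1` is, by Markov's inequality, above a given
threshold after `k` further rounds with probability at most a constant times `ρ ^ k`. All potentials
and thresholds here are polynomially bounded in `n`, so `k` of order `log n` suffices.

For push, the clique of leaves fills like a complete graph (`push_clique`). Once it is full, the `K`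
leaves together hit an internal vertex with constant probability per round
(`push_leaves_to_internal`). Internal vertices push along each tree edge with probability at least
1/3, so logarithmic tree paths are traversed quickly, up to the root and then down to every vertex
(`push_up`, `push_down`).

For meet-exchange, agents live mostly on the clique, and those in the tree drift back to it: the
Lyapunov function `potential` contracts off the leaves. With few agents on internal vertices, the
source is soon visited (`meet_start_contract`). Then the weight of informed agents, each counted
with the inverse of its potential, grows: its reciprocal contracts by Cauchy–Schwarz
(`meet_growth_contract`). Once a positive fraction is informed, each remaining agent meets an
informed one at a constant rate while on leaves (`meet_finish_contract`). -/

/-! ### Processes driven by a finite Markov chain -/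

/-- `Y` is a Markov chain with transition weights `κ`, expressed by its finite-dimensional laws. -/
structure IsDriven {Ω E : Type*} [MeasurableSpace Ω] [MeasurableSpace E] (μ : Measure Ω)
    (Y : ℕ → Ω → E) (κ : E → E → ℝ) : Prop where
  measurable : ∀ t, Measurable (Y t)
  markov : ∀ t (ξ : ℕ → E), μ.real {ω | ∀ i ≤ t + 1, Y i ω = ξ i} =
    μ.real {ω | ∀ i ≤ t, Y i ω = ξ i} * κ (ξ t) (ξ (t + 1))

/-- `f` is a function of `Y 0, …, Y t`. -/
def DeterminedAt {Ω E β : Type*} (Y : ℕ → Ω → E) (t : ℕ) (f : Ω → β) : Prop :=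
  ∀ ω ω', (∀ i ≤ t, Y i ω = Y i ω') → f ω = f ω'

section Driven

variable {Ω E : Type*} {Y : ℕ → Ω → E}

lemma DeterminedAt.mono {β : Type*} {f : Ω → β} {s t : ℕ} (h : DeterminedAt Y s f) (hst : s ≤ t) :
    DeterminedAt Y t f := fun ω ω' hω => h ω ω' fun i hi => hω i (hi.trans hst)

/-- When `E` is finite, histories up to time `t` range over a finite type, so this factorization
makes measurability and integrability automatic and turns expectations into finite sums. -/
lemma DeterminedAt.exists_factor {β : Type*} [Nonempty β] {f : Ω → β} {t : ℕ}
    (h : DeterminedAt Y t f) :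
    ∃ F : (Fin (t + 1) → E) → β, ∀ ω, f ω = F fun i => Y i ω := by
  classical
  refine ⟨Function.extend (fun ω (i : Fin (t + 1)) => Y i ω) f fun _ => Classical.arbitrary β,
    fun ω => ?_⟩
  rw [Function.FactorsThrough.extend_apply]
  intro ω ω' hω
  exact h ω ω' fun i hi => congrFun hω ⟨i, by omega⟩

lemma measurable_hist [MeasurableSpace Ω] [MeasurableSpace E] (hY : ∀ t, Measurable (Y t)) (t : ℕ) :
    Measurable fun ω (i : Fin (t + 1)) => Y i ω :=
  measurable_pi_lambda _ fun i => hY i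


variable [MeasurableSpace Ω] [MeasurableSpace E] [Fintype E]
  [MeasurableSingletonClass E] {μ : Measure Ω} [IsProbabilityMeasure μ] {κ : E → E → ℝ}

lemma DeterminedAt.measurable {β : Type*} [MeasurableSpace β] [Nonempty β]
    (hY : ∀ t, Measurable (Y t)) {f : Ω → β} {t : ℕ} (h : DeterminedAt Y t f) :
    Measurable f := by
  obtain ⟨F, hF⟩ := h.exists_factor
  rw [funext hF]
  exact (Measurable.of_discrete (f := F)).comp (measurable_hist hY t)

lemma DeterminedAt.integrable (hY : ∀ t, Measurable (Y t)) {f : Ω → ℝ} {t : ℕ}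
    (h : DeterminedAt Y t f) : Integrable f μ := by
  obtain ⟨F, hF⟩ := h.exists_factor
  rw [funext hF]
  have := Integrable.of_finite (f := F) (μ := μ.map fun ω (i : Fin (t + 1)) => Y i ω)
  exact this.comp_measurable (measurable_hist hY t)

lemma integral_comp_finite {D : Type*} [Fintype D] [MeasurableSpace D]
    [MeasurableSingletonClass D] {Z : Ω → D} (hZ : Measurable Z) (F : D → ℝ) :
    ∫ ω, F (Z ω) ∂μ = ∑ d, μ.real {ω | Z ω = d} * F d := by
  rw [← integral_map (φ := Z) (f := F) hZ.aemeasurable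
    (Measurable.of_discrete).aestronglyMeasurable]
  rw [integral_fintype Integrable.of_finite]
  refine Finset.sum_congr rfl fun d _ => ?_
  rw [smul_eq_mul, map_measureReal_apply hZ (measurableSet_singleton d)]
  rfl

/-- This is the Markov property as an identity of expectations, with no conditional expectation:
both sides are sums over finite histories, compared term by term through `markov`. -/
lemma IsDriven.integral_step (hY : IsDriven μ Y κ) {t : ℕ} {g : Ω → E → ℝ}
    (hg : DeterminedAt Y t g) :
    ∫ ω, g ω (Y (t + 1) ω) ∂μ = ∫ ω, ∑ y, κ (Y t ω) y * g ω y ∂μ := by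
  obtain ⟨G, hG⟩ := hg.exists_factor
  simp_rw [hG]
  have h1 := integral_comp_finite (μ := μ)
    ((measurable_hist hY.measurable t).prodMk (hY.measurable (t + 1))) fun p => G p.1 p.2
  have h2 := integral_comp_finite (μ := μ) (measurable_hist hY.measurable t)
    fun h => ∑ y, κ (h (Fin.last t)) y * G h y
  simp only [Fin.val_last] at h1 h2
  rw [h1, h2, Fintype.sum_prod_type]
  refine Finset.sum_congr rfl fun h _ => ?_
  rw [Finset.mul_sum]
  refine Finset.sum_congr rfl fun y _ => ?_
  have := hY.markov t fun i => if hi : i < t + 1 then h ⟨i, hi⟩ else y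
  simp only [Nat.lt_succ_self, lt_irrefl, dite_true, dite_false] at this
  have e1 : {ω | ((fun i : Fin (t + 1) => Y i ω), Y (t + 1) ω) = (h, y)} =
      {ω | ∀ i ≤ t + 1, Y i ω = if hi : i < t + 1 then h ⟨i, hi⟩ else y} := by
    ext ω
    simp only [Prod.mk.injEq, funext_iff, Set.mem_ofPred_eq]
    constructor
    · rintro ⟨h1, h2⟩ i hi
      split_ifs with hlt
      · exact h1 ⟨i, hlt⟩
      · obtain rfl : i = t + 1 := by omega
        exact h2
    · intro h1
      refine ⟨fun i => ?_, ?_⟩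
      · have := h1 i (by omega)
        rwa [dif_pos i.2] at this
      · have := h1 (t + 1) le_rfl
        rwa [dif_neg (by omega)] at this
  have e2 : {ω | (fun i : Fin (t + 1) => Y i ω) = h} =
      {ω | ∀ i ≤ t, Y i ω = if hi : i < t + 1 then h ⟨i, hi⟩ else y} := by
    ext ω
    simp only [funext_iff, Set.mem_ofPred_eq]
    constructor
    · intro h1 i hi
      rw [dif_pos (by omega)]
      exact h1 ⟨i, by omega⟩
    · intro h1 i
      have := h1 i (by omega)
      rwa [dif_pos i.2] at this
  rw [e1, e2, this, mul_assoc]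
  rfl

variable {S : Type*} {Z : ℕ → Ω → S} {F : S → E → S} {f : S → ℝ} {C G : Set S} {M ρ : ℝ}

/-- Exponential decay of a potential `f` along a process driven by a Markov chain: if `f` contracts
in expectation by the factor `ρ` at every good state, then it is unlikely to remain large. -/
lemma IsDriven.measureReal_le_of_contracting (hY : IsDriven μ Y κ)
    (hZ : ∀ t, DeterminedAt Y t (Z t)) (hF : ∀ t ω, Z (t + 1) ω = F (Z t ω) (Y (t + 1) ω))
    (hf : ∀ z, 0 ≤ f z) (hM : ∀ z ∈ C, f z ≤ M) (hM0 : 0 ≤ M) (hρ : 0 ≤ ρ)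
    (hC : ∀ z y, z ∈ C → F z y ∈ C)
    (hdec : ∀ t ω, Z t ω ∈ C → Z t ω ∈ G →
      ∑ y, κ (Y t ω) y * f (F (Z t ω) y) ≤ ρ * f (Z t ω))
    (t k : ℕ) {a : ℝ} (ha : 0 < a) :
    μ.real {ω | Z t ω ∈ C ∧ (∀ i < t + k, Z i ω ∈ G) ∧ a ≤ f (Z (t + k) ω)} ≤ M * ρ ^ k / a := by
  classical
  have hCt : ∀ ω k, Z t ω ∈ C → Z (t + k) ω ∈ C := fun ω k h => by
    induction k with
    | zero => exact h
    | succ k ih => rw [← add_assoc, hF]; exact hC _ _ ih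
  -- The potential is killed as soon as a state leaves `G`, and from the start if `Z t` is outside
  -- `C`. The killed potential contracts in expectation without any conditioning.
  set ψ : ℕ → Ω → ℝ := fun k ω =>
    if Z t ω ∈ C ∧ ∀ i < t + k, Z i ω ∈ G then f (Z (t + k) ω) else 0 with hψ
  have hdet : ∀ k, DeterminedAt Y (t + k) (ψ k) := fun k ω ω' h => by
    have h1 : ∀ i ≤ t + k, Z i ω = Z i ω' := fun i hi => (hZ i).mono hi _ _ h
    simp only [hψ]
    rw [h1 t (by omega), h1 (t + k) le_rfl]
    congr 1
    simp only [eq_iff_iff, and_congr_right_iff]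
    intro _
    exact forall₂_congr fun i hi => by rw [h1 i hi.le]
  have hint : ∀ k, Integrable (ψ k) μ := fun k => (hdet k).integrable hY.measurable
  have hψ0 : ∀ k ω, 0 ≤ ψ k ω := fun k ω => by
    simp only [hψ]; split_ifs; exacts [hf _, le_rfl]
  have hI : ∀ k, ∫ ω, ψ k ω ∂μ ≤ M * ρ ^ k := by
    intro k
    induction k with
    | zero =>
      have : ∫ ω, ψ 0 ω ∂μ ≤ ∫ _ω, M ∂μ := by
        refine integral_mono (hint 0) (integrable_const _) fun ω => ?_
        simp only [hψ, add_zero]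
        split_ifs with h
        · exact hM _ h.1
        · exact hM0
      simpa using this
    | succ k ih =>
      -- The killing condition for stage `k + 1` involves only times up to `t + k`, so it is known
      -- before the step `t + k → t + k + 1` is averaged.
      set g : Ω → E → ℝ := fun ω y =>
        if Z t ω ∈ C ∧ ∀ i < t + (k + 1), Z i ω ∈ G then f (F (Z (t + k) ω) y) else 0 with hg
      have hgdet : DeterminedAt Y (t + k) g := fun ω ω' h => by
        have h1 : ∀ i ≤ t + k, Z i ω = Z i ω' := fun i hi => (hZ i).mono hi _ _ h
        funext y
        simp only [hg]
        rw [h1 t (by omega), h1 (t + k) le_rfl]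
        congr 1
        simp only [eq_iff_iff, and_congr_right_iff]
        intro _
        exact forall₂_congr fun i hi => by rw [h1 i (by omega)]
      have e1 : ∀ ω, ψ (k + 1) ω = g ω (Y (t + k + 1) ω) := fun ω => by
        simp only [hψ, hg, ← add_assoc, hF]
      simp_rw [e1]
      rw [hY.integral_step hgdet]
      have hle : ∫ ω, ∑ y, κ (Y (t + k) ω) y * g ω y ∂μ ≤ ∫ ω, ρ * ψ k ω ∂μ := by
        refine integral_mono (DeterminedAt.integrable (Y := Y) (t := t + k) hY.measurable
          fun ω ω' h => ?_) ((hint k).const_mul ρ) fun ω => ?_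
        · simp only [h (t + k) le_rfl, hgdet ω ω' h]
        · by_cases hω : Z t ω ∈ C ∧ ∀ i < t + (k + 1), Z i ω ∈ G
          · have h2 : ∀ i < t + k, Z i ω ∈ G := fun i hi => hω.2 i (by omega)
            simp only [hg, hψ, if_pos hω, if_pos (And.intro hω.1 h2)]
            exact hdec (t + k) ω (hCt ω k hω.1) (hω.2 _ (by omega))
          · simp only [hg, if_neg hω, mul_zero, Finset.sum_const_zero]
            exact mul_nonneg hρ (hψ0 k ω)
      rw [integral_const_mul] at hle
      calc _ ≤ _ := hle
        _ ≤ ρ * (M * ρ ^ k) := by gcongr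
        _ = _ := by ring
  have hmk := mul_meas_ge_le_integral_of_nonneg (μ := μ) (f := ψ k)
    (Filter.Eventually.of_forall (hψ0 k)) (hint k) a
  rw [le_div_iff₀ ha, mul_comm]
  refine le_trans ?_ (hmk.trans (hI k))
  refine mul_le_mul_of_nonneg_left (measureReal_mono fun ω hω => ?_) ha.le
  simp only [Set.mem_ofPred_eq, hψ, if_pos (And.intro hω.1 hω.2.1)]
  exact hω.2.2

end Driven

/-! ### Expectations over independent coordinates -/

section ProductExpectation

variable {ι V : Type*} [Fintype ι] [Fintype V] [DecidableEq ι]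

/-- Expectation of `f` when the coordinates are independent with laws `q i`. -/
noncomputable def prodExp (q : ι → V → ℝ) (f : (ι → V) → ℝ) : ℝ := ∑ y, (∏ i, q i (y i)) * f y

/-- `q i` is a probability vector for every `i`. -/
structure IsProbRows (q : ι → V → ℝ) : Prop where
  nonneg : ∀ i v, 0 ≤ q i v
  sum_eq : ∀ i, ∑ v, q i v = 1

variable {q : ι → V → ℝ} {f g : (ι → V) → ℝ}

lemma prodExp_mono (hq : IsProbRows q) (h : ∀ y, f y ≤ g y) : prodExp q f ≤ prodExp q g :=
  Finset.sum_le_sum fun y _ =>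
    mul_le_mul_of_nonneg_left (h y) (Finset.prod_nonneg fun i _ => hq.nonneg i _)

lemma prodExp_sub : prodExp q (fun y => f y - g y) = prodExp q f - prodExp q g := by
  simp only [prodExp, mul_sub, Finset.sum_sub_distrib]

lemma prodExp_const_mul (c : ℝ) : prodExp q (fun y => c * f y) = c * prodExp q f := by
  simp only [prodExp, Finset.mul_sum]
  exact Finset.sum_congr rfl fun y _ => by ring

lemma prodExp_sum {β : Type*} (s : Finset β) (F : β → (ι → V) → ℝ) :
    prodExp q (fun y => ∑ b ∈ s, F b y) = ∑ b ∈ s, prodExp q (F b) := by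
  simp only [prodExp, Finset.mul_sum]
  exact Finset.sum_comm

/-- Padding with factors 1 outside `s` makes the integrand a full product, and the padded
coordinates sum to 1. The one-round probabilities computed later all come from this factorization.
-/
lemma prodExp_prod (hq : IsProbRows q) (s : Finset ι) (φ : ι → V → ℝ) :
    prodExp q (fun y => ∏ i ∈ s, φ i (y i)) = ∏ i ∈ s, ∑ v, q i v * φ i v := by
  have h1 : ∀ y : ι → V, (∏ i, q i (y i)) * ∏ i ∈ s, φ i (y i) =
      ∏ i, q i (y i) * (if i ∈ s then φ i (y i) else 1) := fun y => by
    rw [Finset.prod_mul_distrib, Finset.prod_ite_mem, Finset.univ_inter]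
  simp only [prodExp, h1]
  have h2 := Finset.prod_univ_sum (fun _ : ι => (Finset.univ : Finset V))
    fun i v => q i v * (if i ∈ s then φ i v else 1)
  rw [Fintype.piFinset_univ] at h2
  rw [← h2]
  conv_rhs => rw [← Finset.univ_inter s, ← Finset.prod_ite_mem]
  refine Finset.prod_congr rfl fun i _ => ?_
  by_cases hi : i ∈ s
  · simp [hi]
  · simp [hi, hq.sum_eq i]

lemma prodExp_const (hq : IsProbRows q) (c : ℝ) : prodExp q (fun _ => c) = c := by
  have h := prodExp_prod hq ∅ fun _ _ => 1
  have h2 := prodExp_const_mul (q := q) (f := fun _ => 1) c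
  simp only [Finset.prod_empty, mul_one] at h h2
  rw [h2, h, mul_one]

lemma prodExp_coord (hq : IsProbRows q) (i : ι) (φ : V → ℝ) :
    prodExp q (fun y => φ (y i)) = ∑ v, q i v * φ v := by
  simpa using prodExp_prod hq {i} fun _ => φ

end ProductExpectation

/-! ### Random steps on a finite graph -/

section Graph

variable {V : Type*} [Fintype V] (G : SimpleGraph V)

lemma stepProb_nonneg {V : Type*} (G : SimpleGraph V) (u v : V) : 0 ≤ stepProb G u v := by
  unfold stepProb
  split_ifs <;> positivity

lemma stationaryProb_nonneg {V : Type*} (G : SimpleGraph V) (v : V) : 0 ≤ stationaryProb G v := by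
  unfold stationaryProb
  positivity

lemma sum_stepProb_mul {u : V} {s : Finset V} (hs : ∀ v, v ∈ s ↔ G.Adj u v) (f : V → ℝ) :
    ∑ v, stepProb G u v * f v = (∑ v ∈ s, f v) / s.card := by
  classical
  have h : (G.neighborSet u).ncard = s.card := by
    rw [← Set.ncard_coe_finset]
    congr 1
    ext v
    simp [hs]
  have h2 : ∀ v, stepProb G u v * f v = if v ∈ s then f v / s.card else 0 := fun v => by
    unfold stepProb
    by_cases huv : G.Adj u v
    · rw [if_pos huv, if_pos ((hs v).2 huv), h]; ring
    · rw [if_neg huv, if_neg (mt (hs v).1 huv), zero_mul]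
  simp only [h2, Finset.sum_ite_mem, Finset.univ_inter, Finset.sum_div]

lemma stepProb_eq [DecidableEq V] {u v : V} {s : Finset V} (hs : ∀ v, v ∈ s ↔ G.Adj u v) :
    stepProb G u v = if v ∈ s then 1 / (s.card : ℝ) else 0 := by
  have h := sum_stepProb_mul G hs fun w => if w = v then 1 else 0
  simp only [mul_ite, mul_one, mul_zero, Finset.sum_ite_eq', Finset.mem_univ, if_true] at h
  rw [h]
  split_ifs <;> simp

lemma sum_stepProb {u w : V} (hw : G.Adj u w) : ∑ v, stepProb G u v = 1 := by
  classical
  have hs : ∀ v, v ∈ G.neighborFinset u ↔ G.Adj u v := fun v => by simp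
  have h := sum_stepProb_mul G hs fun _ => 1
  simp only [mul_one, Finset.sum_const, nsmul_eq_mul] at h
  rw [h, div_self]
  exact Nat.cast_ne_zero.mpr (Finset.card_ne_zero_of_mem ((hs w).2 hw))

lemma sum_ncard_neighborSet :
    ∑ v, ((G.neighborSet v).ncard : ℝ) = 2 * G.edgeSet.ncard := by
  classical
  have h := G.sum_degrees_eq_twice_card_edges
  have h1 : ∀ v, (G.neighborSet v).ncard = G.degree v := fun v => by
    rw [← SimpleGraph.card_neighborFinset_eq_degree, ← Set.ncard_coe_finset,
      SimpleGraph.coe_neighborFinset]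
  have h2 : G.edgeSet.ncard = G.edgeFinset.card := by
    rw [← Set.ncard_coe_finset, SimpleGraph.coe_edgeFinset]
  simp only [h1, h2]
  exact_mod_cast h

/-- Reversibility: the flow through each oriented edge is `1 / (2 |E|)`, whatever the degree of its
origin. -/
lemma sum_stationaryProb_mul_stepProb (v : V) :
    ∑ u, stationaryProb G u * stepProb G u v = stationaryProb G v := by
  classical
  have h : ∀ u, stationaryProb G u * stepProb G u v =
      if u ∈ G.neighborFinset v then 1 / (2 * (G.edgeSet.ncard : ℝ)) else 0 := fun u => by
    unfold stationaryProb stepProb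
    by_cases huv : G.Adj u v
    · rw [if_pos huv, if_pos ((SimpleGraph.mem_neighborFinset _ _ _).2 huv.symm)]
      have : (G.neighborSet u).ncard ≠ 0 :=
        (Set.ncard_ne_zero_of_mem (show v ∈ G.neighborSet u from huv))
      have : ((G.neighborSet u).ncard : ℝ) ≠ 0 := by exact_mod_cast this
      field_simp
    · rw [if_neg huv, if_neg (mt (SimpleGraph.mem_neighborFinset _ _ _).1 fun h => huv h.symm),
        mul_zero]
  simp only [h, Finset.sum_ite_mem, Finset.univ_inter, Finset.sum_const, nsmul_eq_mul]
  unfold stationaryProb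
  rw [← Set.ncard_coe_finset, SimpleGraph.coe_neighborFinset]
  ring

end Graph

/-! ### The structure of the heavy binary tree -/

namespace BalancedBinaryTree

variable {n : ℕ} (T : BalancedBinaryTree n)

open Classical in
/-- The set of leaves. -/
noncomputable def leaves : Finset (Fin n) := Finset.univ.filter T.IsLeaf

open Classical in
/-- The children of a vertex. -/
noncomputable def children (u : Fin n) : Finset (Fin n) := Finset.univ.filter (T.IsChild u)

/-- The largest depth of a vertex. -/
def height : ℕ := Finset.univ.sup T.depth

variable {T}

@[simp] lemma mem_leaves {u : Fin n} : u ∈ T.leaves ↔ T.IsLeaf u := by simp [leaves]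

@[simp] lemma mem_children {u v : Fin n} : v ∈ T.children u ↔ T.IsChild u v := by simp [children]

lemma depth_le_height (v : Fin n) : T.depth v ≤ T.height := Finset.le_sup (Finset.mem_univ v)

lemma IsChild.depth_eq {u v : Fin n} (h : T.IsChild u v) : T.depth v = T.depth u + 1 := by
  rw [T.depth_eq v h.1, h.2]

lemma isChild_parent {v : Fin n} (h : v ≠ T.root) : T.IsChild (T.parent v) v := ⟨h, rfl⟩

lemma not_isLeaf_parent {v : Fin n} (h : v ≠ T.root) : ¬ T.IsLeaf (T.parent v) :=
  fun hl => hl v (isChild_parent h)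

lemma eq_root_of_depth {v : Fin n} (h : T.depth v = 0) : v = T.root := by
  by_contra hv
  have := T.depth_eq v hv
  omega

lemma ncard_children (u : Fin n) :
    {v | v ≠ T.root ∧ T.parent v = u}.ncard = (T.children u).card := by
  rw [← Set.ncard_coe_finset]
  congr 1
  ext v
  simp [IsChild]

lemma card_children_le_two (u : Fin n) : (T.children u).card ≤ 2 :=
  ncard_children (T := T) u ▸ T.card_children_le u

/-- The fullness condition in the form used below: missing children occur only in the last two
levels. -/
lemma height_le_of_card_children_lt {u : Fin n} (h : (T.children u).card < 2) :
    T.height ≤ T.depth u + 1 :=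
  Finset.sup_le fun w _ => T.balanced u (by rwa [ncard_children]) w

lemma IsLeaf.card_children {u : Fin n} (h : T.IsLeaf u) : (T.children u).card = 0 := by
  rw [Finset.card_eq_zero, Finset.eq_empty_iff_forall_notMem]
  exact fun v hv => h v (mem_children.1 hv)

lemma card_children_pos {u : Fin n} (h : ¬ T.IsLeaf u) : 0 < (T.children u).card := by
  obtain ⟨v, hv⟩ := not_forall_not.1 h
  exact Finset.card_pos.2 ⟨v, mem_children.2 hv⟩

lemma IsLeaf.height_le {u : Fin n} (h : T.IsLeaf u) : T.height ≤ T.depth u + 1 :=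
  height_le_of_card_children_lt (by rw [h.card_children]; norm_num)

lemma depth_lt_height {u : Fin n} (h : ¬ T.IsLeaf u) : T.depth u < T.height := by
  obtain ⟨v, hv⟩ := not_forall_not.1 h
  have := hv.depth_eq
  have := depth_le_height (T := T) v
  omega

lemma card_leaves_eq : T.leaves.card = (n + 1) / 2 := by
  rw [← T.card_leaves, ← Set.ncard_coe_finset]
  congr 1
  ext v
  simp [IsLeaf, IsChild]

lemma not_isLeaf_root (hn : 2 ≤ n) : ¬ T.IsLeaf T.root := by
  intro h
  have h1 := h.height_le
  rw [T.depth_root] at h1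
  have : Nontrivial (Fin n) := Fin.nontrivial_iff_two_le.2 hn
  obtain ⟨v, hv⟩ := exists_ne T.root
  refine h v ⟨hv, eq_root_of_depth ?_⟩
  have h2 := T.depth_eq v hv
  have h3 := depth_le_height (T := T) v
  omega

lemma IsLeaf.ne_root (hn : 2 ≤ n) {v : Fin n} (h : T.IsLeaf v) : v ≠ T.root := by
  rintro rfl
  exact not_isLeaf_root hn h

lemma IsChild.ne {u v : Fin n} (h : T.IsChild u v) : u ≠ v := by
  rintro rfl
  have := h.depth_eq
  omega

lemma adj_iff {u v : Fin n} : T.heavyGraph.Adj u v ↔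
    u ≠ v ∧ (T.IsChild u v ∨ T.IsChild v u ∨ (T.IsLeaf u ∧ T.IsLeaf v)) := by
  rw [heavyGraph, SimpleGraph.fromRel_adj]
  tauto

lemma IsLeaf.adj_iff (hn : 2 ≤ n) {u v : Fin n} (h : T.IsLeaf u) :
    v ∈ insert (T.parent u) (T.leaves.erase u) ↔ T.heavyGraph.Adj u v := by
  rw [BalancedBinaryTree.adj_iff, Finset.mem_insert, Finset.mem_erase, mem_leaves]
  constructor
  · rintro (rfl | ⟨h1, h2⟩)
    · have := isChild_parent (h.ne_root hn)
      exact ⟨this.ne.symm, Or.inr (Or.inl this)⟩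
    · exact ⟨h1.symm, Or.inr (Or.inr ⟨h, h2⟩)⟩
  · rintro ⟨h1, h2 | h2 | h2⟩
    · exact (h v h2).elim
    · exact Or.inl h2.2.symm
    · exact Or.inr ⟨h1.symm, h2.2⟩

/-- The parent takes the place of the leaf itself, which makes the degree of a leaf exactly the
number of leaves and each of its steps have probability `1 / K`. -/
lemma IsLeaf.card_neighbors (hn : 2 ≤ n) {u : Fin n} (h : T.IsLeaf u) :
    (insert (T.parent u) (T.leaves.erase u)).card = T.leaves.card := by
  rw [Finset.card_insert_of_notMem, Finset.card_erase_add_one (mem_leaves.2 h)]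
  intro hm
  exact not_isLeaf_parent (h.ne_root hn) (mem_leaves.1 (Finset.mem_of_mem_erase hm))

lemma IsLeaf.stepProb_leaf (hn : 2 ≤ n) {u v : Fin n} (h : T.IsLeaf u) (hv : T.IsLeaf v)
    (huv : v ≠ u) : stepProb T.heavyGraph u v = 1 / (T.leaves.card : ℝ) := by
  rw [stepProb_eq _ fun v => h.adj_iff hn, h.card_neighbors hn, if_pos]
  simp [huv, hv]

lemma IsLeaf.stepProb_parent (hn : 2 ≤ n) {u : Fin n} (h : T.IsLeaf u) :
    stepProb T.heavyGraph u (T.parent u) = 1 / (T.leaves.card : ℝ) := by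
  rw [stepProb_eq _ fun v => h.adj_iff hn, h.card_neighbors hn, if_pos]
  simp

lemma IsLeaf.stepProb_le (hn : 2 ≤ n) {u : Fin n} (h : T.IsLeaf u) (v : Fin n) :
    stepProb T.heavyGraph u v ≤ 1 / (T.leaves.card : ℝ) := by
  rw [stepProb_eq _ fun v => h.adj_iff hn, h.card_neighbors hn]
  split_ifs
  · exact le_rfl
  · positivity

lemma internal_adj_iff {u v : Fin n} (h : ¬ T.IsLeaf u) :
    v ∈ T.children u ∪ (if u = T.root then ∅ else {T.parent u}) ↔ T.heavyGraph.Adj u v := by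
  rw [adj_iff, Finset.mem_union, mem_children]
  by_cases hu : u = T.root
  · simp only [hu, if_true, Finset.notMem_empty, or_false]
    subst hu
    constructor
    · exact fun h => ⟨h.ne, Or.inl h⟩
    · rintro ⟨h1, h2 | h2 | h2⟩
      exacts [h2, (h2.1 rfl).elim, (h h2.1).elim]
  · simp only [hu, if_false, Finset.mem_singleton]
    constructor
    · rintro (h1 | rfl)
      · exact ⟨h1.ne, Or.inl h1⟩
      · exact ⟨(isChild_parent hu).ne.symm, Or.inr (Or.inl (isChild_parent hu))⟩
    · rintro ⟨h1, h2 | h2 | h2⟩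
      exacts [Or.inl h2, Or.inr h2.2.symm, (h h2.1).elim]

lemma card_internal_neighbors (u : Fin n) :
    (T.children u ∪ (if u = T.root then ∅ else {T.parent u})).card =
      (T.children u).card + if u = T.root then 0 else 1 := by
  rw [Finset.card_union_of_disjoint]
  · split_ifs <;> simp
  · split_ifs with hu
    · simp
    · rw [Finset.disjoint_singleton_right, mem_children]
      intro h
      have h1 := h.depth_eq
      have h2 := (isChild_parent hu).depth_eq
      omega

lemma internal_one_third_le_stepProb {u v : Fin n} (h : ¬ T.IsLeaf u)
    (hv : T.heavyGraph.Adj u v) : 1 / 3 ≤ stepProb T.heavyGraph u v := by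
  have h0 := card_children_pos h
  have h2 := card_children_le_two (T := T) u
  rw [stepProb_eq _ fun v => internal_adj_iff h, if_pos ((internal_adj_iff h).2 hv),
    card_internal_neighbors]
  apply one_div_le_one_div_of_le
  · exact_mod_cast Nat.add_pos_left h0 _
  · have : (T.children u).card + (if u = T.root then 0 else 1) ≤ 3 := by split_ifs <;> omega
    exact_mod_cast this

lemma ncard_neighborSet_of_internal {u : Fin n} (h : ¬ T.IsLeaf u) :
    (T.heavyGraph.neighborSet u).ncard ≤ 3 := by
  have : T.heavyGraph.neighborSet u =
      ↑(T.children u ∪ (if u = T.root then ∅ else {T.parent u})) := by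
    ext v
    rw [Finset.mem_coe, internal_adj_iff h, SimpleGraph.mem_neighborSet]
  rw [this, Set.ncard_coe_finset, card_internal_neighbors]
  have h2 := card_children_le_two (T := T) u
  split_ifs <;> omega

lemma ncard_neighborSet_of_isLeaf (hn : 2 ≤ n) {u : Fin n} (h : T.IsLeaf u) :
    (T.heavyGraph.neighborSet u).ncard = T.leaves.card := by
  have : T.heavyGraph.neighborSet u = ↑(insert (T.parent u) (T.leaves.erase u)) := by
    ext v
    rw [Finset.mem_coe, h.adj_iff hn, SimpleGraph.mem_neighborSet]
  rw [this, Set.ncard_coe_finset, h.card_neighbors hn]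

lemma exists_adj (hn : 2 ≤ n) (u : Fin n) : ∃ v, T.heavyGraph.Adj u v := by
  by_cases h : T.IsLeaf u
  · exact ⟨T.parent u, (h.adj_iff hn).1 (Finset.mem_insert_self _ _)⟩
  · obtain ⟨v, hv⟩ := not_forall_not.1 h
    exact ⟨v, adj_iff.2 ⟨hv.ne, Or.inl hv⟩⟩

variable (T) in
lemma isProbRows (hn : 2 ≤ n) {ι : Type*} (x : ι → Fin n) :
    IsProbRows fun i => stepProb T.heavyGraph (x i) where
  nonneg i v := stepProb_nonneg _ _ _
  sum_eq i := by
    obtain ⟨w, hw⟩ := exists_adj (T := T) hn (x i)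
    exact sum_stepProb _ hw

variable (T) in
lemma sq_card_leaves_le (hn : 2 ≤ n) :
    (T.leaves.card : ℝ) ^ 2 ≤ 2 * T.heavyGraph.edgeSet.ncard := by
  rw [← sum_ncard_neighborSet]
  calc (T.leaves.card : ℝ) ^ 2 = ∑ v ∈ T.leaves, ((T.heavyGraph.neighborSet v).ncard : ℝ) := by
        rw [Finset.sum_congr rfl fun v hv => by
          rw [ncard_neighborSet_of_isLeaf hn (mem_leaves.1 hv)]]
        rw [Finset.sum_const, nsmul_eq_mul, sq]
    _ ≤ _ := Finset.sum_le_univ_sum_of_nonneg fun v => by positivity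

variable (T) in
lemma half_le_card_leaves : (n : ℝ) / 2 ≤ T.leaves.card := by
  rw [card_leaves_eq, div_le_iff₀ two_pos]
  have : n ≤ (n + 1) / 2 * 2 := by omega
  exact_mod_cast this

-- The constant is `3 / (1 / 4)`: the degree is at most 3, and the degree sum is at least the square
-- of the number of leaves, hence at least `n ^ 2 / 4`.
variable (T) in
lemma stationaryProb_internal_le (hn : 2 ≤ n) {u : Fin n} (h : ¬ T.IsLeaf u) :
    stationaryProb T.heavyGraph u ≤ 12 / (n : ℝ) ^ 2 := by
  have hn' : (0 : ℝ) < n := by exact_mod_cast (by omega : 0 < n)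
  have h1 := T.sq_card_leaves_le hn
  have h2 := T.half_le_card_leaves
  have h3 : (n : ℝ) ^ 2 / 4 ≤ 2 * T.heavyGraph.edgeSet.ncard := by nlinarith
  have h4 : ((T.heavyGraph.neighborSet u).ncard : ℝ) ≤ 3 := by
    exact_mod_cast ncard_neighborSet_of_internal h
  unfold stationaryProb
  calc _ ≤ 3 / ((n : ℝ) ^ 2 / 4) := by gcongr
    _ = _ := by field_simp; norm_num

/-- A vertex with two further levels at or above the height has two children by `balanced`, so level
sizes double up to the penultimate level. -/
lemma two_pow_le_card_level {d : ℕ} (hd : d + 1 ≤ T.height) :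
    2 ^ d ≤ (Finset.univ.filter fun v => T.depth v = d).card := by
  induction d with
  | zero =>
    rw [pow_zero, Nat.one_le_iff_ne_zero]
    exact Finset.card_ne_zero_of_mem (a := T.root) (by simp [T.depth_root])
  | succ d ih =>
    have ih := ih (by omega)
    have hc : ∀ u ∈ Finset.univ.filter fun v => T.depth v = d, (T.children u).card = 2 := by
      intro u hu
      simp only [Finset.mem_filter, Finset.mem_univ, true_and] at hu
      by_contra hne
      have h2 := card_children_le_two (T := T) u
      have := height_le_of_card_children_lt (T := T) (u := u) (by omega)
      omega
    have hsub : (Finset.univ.filter fun v => T.depth v = d).biUnion T.children ⊆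
        Finset.univ.filter fun v => T.depth v = d + 1 := by
      intro v hv
      simp only [Finset.mem_biUnion, Finset.mem_filter, Finset.mem_univ, true_and,
        mem_children] at hv ⊢
      obtain ⟨u, hu, hv⟩ := hv
      rw [hv.depth_eq, hu]
    have h3 := Finset.card_le_card hsub
    rw [Finset.card_biUnion, Finset.sum_congr rfl hc, Finset.sum_const, smul_eq_mul] at h3
    · rw [pow_succ]
      omega
    · intro u _ v _ huv
      rw [Function.onFun, Finset.disjoint_left]
      intro w hw hw'
      exact huv ((mem_children.1 hw).2.symm.trans (mem_children.1 hw').2)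

/-- The height is logarithmic, so weights exponential in the depth, such as `2 ^ depth` and `(3 / 2)
^ height`, stay linear in `n`. -/
lemma two_pow_height_le : 2 ^ T.height ≤ 2 * n := by
  rcases Nat.eq_zero_or_pos T.height with h | h
  · rw [h]
    have := T.root.pos
    omega
  · have h1 := two_pow_le_card_level (T := T) (d := T.height - 1) (by omega)
    have h2 := Finset.card_filter_le (Finset.univ : Finset (Fin n))
      fun v => T.depth v = T.height - 1
    rw [Finset.card_univ, Fintype.card_fin] at h2
    obtain ⟨k, hk⟩ := Nat.exists_eq_add_of_lt h
    rw [hk] at h1 h2 ⊢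
    simp only [zero_add, Nat.add_sub_cancel, pow_succ] at h1 h2 ⊢
    omega

/-! ### A Lyapunov function for the walk in the tree -/

open Classical in
variable (T) in
/-- A function that equals `1` on the leaves and contracts in expectation under a step of the
walk from an internal vertex. -/
noncomputable def potential (v : Fin n) : ℝ :=
  if T.IsLeaf v then 1 else 2 * (3 / 2) ^ (T.height - T.depth v)

lemma potential_of_isLeaf {v : Fin n} (h : T.IsLeaf v) : T.potential v = 1 := if_pos h

lemma potential_of_internal {v : Fin n} (h : ¬ T.IsLeaf v) :
    T.potential v = 2 * (3 / 2) ^ (T.height - T.depth v) := if_neg h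

lemma one_le_potential (v : Fin n) : 1 ≤ T.potential v := by
  unfold potential
  split_ifs
  · exact le_rfl
  · have : (1 : ℝ) ≤ (3 / 2) ^ (T.height - T.depth v) := one_le_pow₀ (by norm_num)
    linarith

lemma potential_le (v : Fin n) : T.potential v ≤ 4 * n := by
  have hn : (1 : ℝ) ≤ n := by exact_mod_cast v.pos
  have h1 : ((2 : ℝ) ^ T.height) ≤ 2 * n := by exact_mod_cast two_pow_height_le (T := T)
  unfold potential
  split_ifs
  · linarith
  · calc 2 * (3 / 2 : ℝ) ^ (T.height - T.depth v) ≤ 2 * (3 / 2 : ℝ) ^ T.height := by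
          gcongr
          · norm_num
          · omega
      _ ≤ 2 * 2 ^ T.height := by gcongr; norm_num
      _ ≤ _ := by linarith

/-- With `A = (3 / 2) ^ k`, the vertex has potential `3 * A`, its children at most `2 * A` and its
parent `9 / 2 * A`. Two children outweigh the parent: the average is at most `(17 / 6) * A`, which
is `17 / 18` of `3 * A`. -/
lemma sum_stepProb_mul_potential_internal {u : Fin n} (h : ¬ T.IsLeaf u) :
    ∑ v, stepProb T.heavyGraph u v * T.potential v ≤ 17 / 18 * T.potential u := by
  have hlt := depth_lt_height h
  obtain ⟨k, hk⟩ : ∃ k, T.height = T.depth u + 1 + k := ⟨T.height - T.depth u - 1, by omega⟩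
  set A : ℝ := (3 / 2) ^ k with hA
  have hA1 : 1 ≤ A := one_le_pow₀ (by norm_num)
  have hu : T.potential u = 3 * A := by
    rw [potential_of_internal h, hk, show T.depth u + 1 + k - T.depth u = k + 1 by omega, pow_succ]
    ring
  have hchild : ∀ v ∈ T.children u, T.potential v ≤ 2 * A := fun v hv => by
    have hd := (mem_children.1 hv).depth_eq
    by_cases hl : T.IsLeaf v
    · rw [potential_of_isLeaf hl]; linarith
    · rw [potential_of_internal hl, hk, hd, show T.depth u + 1 + k - (T.depth u + 1) = k by omega]
  have hsum : ∑ v ∈ T.children u, T.potential v ≤ (T.children u).card * (2 * A) := by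
    rw [← nsmul_eq_mul]
    exact Finset.sum_le_card_nsmul _ _ _ hchild
  have h0 := card_children_pos h
  have h2 := card_children_le_two (T := T) u
  have hc : (T.children u).card = 1 ∨ (T.children u).card = 2 := by omega
  rw [sum_stepProb_mul _ fun v => internal_adj_iff h, card_internal_neighbors, hu]
  by_cases hr : u = T.root
  · simp only [hr, if_true, Finset.union_empty, add_zero]
    subst hr
    rw [div_le_iff₀ (by exact_mod_cast h0)]
    refine hsum.trans ?_
    rcases hc with hc | hc <;> rw [hc] <;> push_cast <;> nlinarith
  · have hpar : T.potential (T.parent u) = 9 / 2 * A := by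
      rw [potential_of_internal (not_isLeaf_parent hr), hk, (isChild_parent hr).depth_eq,
        show T.depth (T.parent u) + 1 + 1 + k - T.depth (T.parent u) = k + 2 by omega, pow_add]
      ring
    simp only [hr, if_false]
    rw [Finset.sum_union, Finset.sum_singleton, hpar]
    swap
    · rw [Finset.disjoint_singleton_right, mem_children]
      intro h
      have h1 := h.depth_eq
      have h2 := (isChild_parent hr).depth_eq
      omega
    rw [div_le_iff₀ (by positivity)]
    -- A single child forces `k = 0` and is a leaf of potential 1. The extra factor 2 in the
    -- potential of internal vertices serves this case: the average `(1 + 9 / 2) / 2` is below `17 /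
    -- 18 * 3`.
    rcases hc with hc | hc
    · have hk0 : k = 0 := by
        have := height_le_of_card_children_lt (T := T) (u := u) (by omega)
        omega
      have hA0 : A = 1 := by rw [hA, hk0, pow_zero]
      have hone : ∑ v ∈ T.children u, T.potential v ≤ 1 := by
        obtain ⟨v, hv⟩ := Finset.card_eq_one.1 hc
        rw [hv, Finset.sum_singleton]
        have hvc : v ∈ T.children u := by rw [hv]; exact Finset.mem_singleton_self v
        have hd := (mem_children.1 hvc).depth_eq
        have hl : T.IsLeaf v := by
          by_contra hl
          have := depth_lt_height hl
          omega
        rw [potential_of_isLeaf hl]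
      rw [hc, hA0]
      push_cast
      linarith
    · rw [hc] at hsum ⊢
      push_cast at hsum ⊢
      linarith

/-- Only the parent, chosen with probability `1 / K`, costs more than 1. It lies at most two levels
above the bottom, so its potential is at most `2 * (3 / 2) ^ 2 = 9 / 2`. -/
lemma sum_stepProb_mul_potential_leaf (hn : 2 ≤ n) {u : Fin n} (h : T.IsLeaf u) :
    ∑ v, stepProb T.heavyGraph u v * T.potential v ≤ 1 + 4 / T.leaves.card := by
  have hr := h.ne_root hn
  have hK : 0 < T.leaves.card := Finset.card_pos.2 ⟨u, mem_leaves.2 h⟩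
  have hK' : (0 : ℝ) < T.leaves.card := by exact_mod_cast hK
  rw [sum_stepProb_mul _ fun v => h.adj_iff hn, h.card_neighbors hn, Finset.sum_insert]
  swap
  · intro hm
    exact not_isLeaf_parent (h.ne_root hn) (mem_leaves.1 (Finset.mem_of_mem_erase hm))
  have h1 : ∑ v ∈ T.leaves.erase u, T.potential v = T.leaves.card - 1 := by
    rw [Finset.sum_congr rfl fun v hv =>
      potential_of_isLeaf (mem_leaves.1 (Finset.mem_of_mem_erase hv)), Finset.sum_const,
      Finset.card_erase_of_mem (mem_leaves.2 h), nsmul_eq_mul, mul_one, Nat.cast_sub hK,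
      Nat.cast_one]
  have h2 : T.potential (T.parent u) ≤ 9 / 2 := by
    rw [potential_of_internal (not_isLeaf_parent hr)]
    have h3 := h.height_le
    have h4 := (isChild_parent hr).depth_eq
    calc 2 * (3 / 2 : ℝ) ^ (T.height - T.depth (T.parent u)) ≤ 2 * (3 / 2) ^ 2 := by
          gcongr
          · norm_num
          · omega
      _ = _ := by norm_num
  rw [h1, div_le_iff₀ hK']
  field_simp
  linarith

end BalancedBinaryTree

/-! ### Avoiding a vertex in one step -/

/-- Bernoulli's inequality for `(1 + 1 / K) ^ a`, combined with `(1 - 1 / K) * (1 + 1 / K) ≤ 1`. It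
bounds the probability that `a` independent uniform choices all miss a target, without exponentials.
-/
lemma one_sub_inv_pow_le {K : ℝ} (hK : 1 ≤ K) (a : ℕ) :
    (1 - 1 / K) ^ a ≤ 1 / (1 + a / K) := by
  have hK0 : 0 < K := by linarith
  have h1 : 1 / K ≤ 1 := by rw [div_le_one hK0]; exact hK
  have h0 : 0 < 1 / K := by positivity
  have hb := one_add_mul_le_pow (show (-2 : ℝ) ≤ 1 / K by linarith) a
  rw [le_div_iff₀ (by positivity)]
  calc (1 - 1 / K) ^ a * (1 + a / K) ≤ (1 - 1 / K) ^ a * (1 + 1 / K) ^ a := by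
        refine mul_le_mul_of_nonneg_left ?_ (pow_nonneg (by linarith) _)
        calc 1 + a / K = 1 + a * (1 / K) := by ring
          _ ≤ _ := hb
    _ = (1 - 1 / K * (1 / K)) ^ a := by rw [← mul_pow]; ring
    _ ≤ 1 := pow_le_one₀ (by nlinarith) (by nlinarith)

section

variable {ι V : Type*} [Fintype ι] [Fintype V] [DecidableEq ι] [DecidableEq V] {q : ι → V → ℝ}

omit [Fintype ι] [DecidableEq ι] in
lemma sum_mul_ite_ne (hq : IsProbRows q) (i : ι) (v : V) :
    ∑ w, q i w * (if w = v then 0 else 1) = 1 - q i v := by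
  have h : ∀ w, q i w * (if w = v then 0 else 1) = q i w - if w = v then q i w else 0 :=
    fun w => by split_ifs <;> ring
  simp only [h, Finset.sum_sub_distrib, hq.sum_eq i, Finset.sum_ite_eq', Finset.mem_univ, if_true]

omit [Fintype ι] [DecidableEq ι] [DecidableEq V] in
lemma IsProbRows.le_one (hq : IsProbRows q) (i : ι) (v : V) : q i v ≤ 1 := by
  rw [← hq.sum_eq i]
  exact Finset.single_le_sum (fun w _ => hq.nonneg i w) (Finset.mem_univ v)

lemma prodExp_avoid (hq : IsProbRows q) (J : Finset ι) (w : ι → V) :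
    prodExp q (fun y => ∏ j ∈ J, if y j = w j then 0 else 1) = ∏ j ∈ J, (1 - q j (w j)) := by
  rw [prodExp_prod hq J fun j v => if v = w j then 0 else 1]
  exact Finset.prod_congr rfl fun j _ => sum_mul_ite_ne hq j _

lemma prod_ite_zero_one {β : Type*} (J : Finset β) (p : β → Prop) [DecidablePred p] :
    (∏ j ∈ J, if p j then (0 : ℝ) else 1) = if ∃ j ∈ J, p j then 0 else 1 := by
  split_ifs with h
  · obtain ⟨j, hj, hp⟩ := h
    exact Finset.prod_eq_zero hj (if_pos hp)
  · exact Finset.prod_eq_one fun j hj => if_neg fun hp => h ⟨j, hj, hp⟩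

end

/-! ### `push` -/

section Push

variable {n : ℕ} {Ω : Type*} [MeasurableSpace Ω] {μ : Measure Ω} [IsProbabilityMeasure μ]

/-- One round of `push`. -/
def pushStep {V : Type*} (S : Set V) (y : V → V) : Set V := S ∪ {v | ∃ u ∈ S, y u = v}

omit [IsProbabilityMeasure μ] in
lemma IsNeighborSampling.isDriven {G : SimpleGraph (Fin n)} {N : ℕ → Fin n → Ω → Fin n}
    (h : IsNeighborSampling G μ N) :
    IsDriven μ (fun t ω u => N t u ω) fun _ y => ∏ u, stepProb G u (y u) where
  measurable t := measurable_pi_lambda _ fun u => h.measurable t u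
  markov t ξ := by
    have key : ∀ t, μ.real {ω | ∀ i ≤ t, (fun u => N i u ω) = ξ i} =
        ∏ i ∈ Finset.range (t + 1), ∏ u, stepProb G u (ξ i u) := fun t => by
      have h1 := h.indep.measure_inter_preimage_eq_mul (Finset.range (t + 1) ×ˢ Finset.univ)
        (sets := fun p => {ξ p.1 p.2}) fun p _ => measurableSet_singleton _
      have h2 : {ω | ∀ i ≤ t, (fun u => N i u ω) = ξ i} =
          ⋂ p ∈ Finset.range (t + 1) ×ˢ (Finset.univ : Finset (Fin n)),
            (fun ω => N p.1 p.2 ω) ⁻¹' {ξ p.1 p.2} := by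
        ext ω
        simp only [funext_iff, Set.mem_ofPred_eq, Finset.mem_product, Finset.mem_range,
          Finset.mem_univ, and_true, Set.mem_iInter, Set.mem_preimage, Set.mem_singleton_iff,
          Prod.forall, Nat.lt_succ_iff]
        exact ⟨fun H i u hi => H i hi u, fun H i hi u => H i u hi⟩
      rw [h2, Measure.real, h1, ENNReal.toReal_prod, Finset.prod_product]
      exact Finset.prod_congr rfl fun i _ => Finset.prod_congr rfl fun u _ => h.law i u _
    rw [key, key, Finset.prod_range_succ _ (t + 1)]

omit [MeasurableSpace Ω] in
lemma pushInformed_determinedAt (s : Fin n) (N : ℕ → Fin n → Ω → Fin n) (t : ℕ) :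
    DeterminedAt (fun t ω u => N t u ω) t
      fun ω => pushInformed s (fun t u => N t u ω) t := by
  induction t with
  | zero => exact fun _ _ _ => rfl
  | succ t ih =>
    intro ω ω' h
    have h1 := ih ω ω' fun i hi => h i (by omega)
    have h2 := fun u => congrFun (h (t + 1) le_rfl) u
    simp only [pushInformed] at h1 h2 ⊢
    rw [h1]
    simp only [h2]

lemma pushInformed_mono {V : Type*} (s : V) (N : ℕ → V → V) : Monotone (pushInformed s N) :=
  monotone_nat_of_le_succ fun _ => Set.subset_union_left

lemma source_mem_pushInformed {V : Type*} (s : V) (N : ℕ → V → V) (t : ℕ) :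
    s ∈ pushInformed s N t := pushInformed_mono s N (Nat.zero_le t) rfl

variable {G : SimpleGraph (Fin n)} {N : ℕ → Fin n → Ω → Fin n}

/-- Informed sets only grow, so it is enough that `C` be closed under supersets; no good set is
needed, and `G` is everything. -/
lemma IsNeighborSampling.decay (h : IsNeighborSampling G μ N) (s : Fin n)
    {f : Set (Fin n) → ℝ} {C : Set (Set (Fin n))} {M ρ : ℝ} (hf : ∀ S, 0 ≤ f S)
    (hM : ∀ S ∈ C, f S ≤ M) (hM0 : 0 ≤ M) (hρ : 0 ≤ ρ)
    (hC : ∀ S S', S ⊆ S' → S ∈ C → S' ∈ C)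
    (hdec : ∀ S ∈ C, prodExp (stepProb G) (fun y => f (pushStep S y)) ≤ ρ * f S)
    (t k : ℕ) {a : ℝ} (ha : 0 < a) :
    μ.real {ω | pushInformed s (fun t u => N t u ω) t ∈ C ∧
      a ≤ f (pushInformed s (fun t u => N t u ω) (t + k))} ≤ M * ρ ^ k / a := by
  have := h.isDriven.measureReal_le_of_contracting (G := Set.univ) (f := f) (C := C) (F := pushStep)
    (Z := fun t ω => pushInformed s (fun t u => N t u ω) t) (pushInformed_determinedAt s N)
    (fun t ω => rfl) hf hM hM0 hρ (fun S y => hC _ _ Set.subset_union_left)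
    (fun t ω hω _ => hdec _ hω) t k ha
  simpa using this

open Classical in
/-- The rumor spreads quickly along a path all of whose steps have substantial probability. -/
lemma IsNeighborSampling.path (h : IsNeighborSampling G μ N) (s : Fin n)
    (hq : IsProbRows (stepProb G)) (w : ℕ → Fin n) (l : ℕ)
    (hw : ∀ i < l, 1 / 3 ≤ stepProb G (w i) (w (i + 1))) (t k : ℕ) :
    μ.real {ω | w 0 ∈ pushInformed s (fun t u => N t u ω) t ∧
      w l ∉ pushInformed s (fun t u => N t u ω) (t + k)} ≤ 2 ^ l * (5 / 6) ^ k := by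
  set x : Set (Fin n) → ℕ → ℝ := fun S i => if w i ∈ S then 0 else 1 with hx
  have hx0 : ∀ S i, 0 ≤ x S i := fun S i => by simp only [hx]; split_ifs <;> norm_num
  have hx1 : ∀ S i, x S i ≤ 1 := fun S i => by simp only [hx]; split_ifs <;> norm_num
  -- Weights halve along the path. A missing vertex survives a round with probability at most 2/3 if
  -- its predecessor is informed; otherwise a third of its weight is charged to the missing
  -- predecessor, which weighs twice as much. The factor is `2 / 3 + 1 / 3 * 1 / 2 = 5 / 6`.
  set f : Set (Fin n) → ℝ := fun S => ∑ i ∈ Finset.range l, (1 / 2) ^ (i + 1) * x S (i + 1) with hf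
  have hone : ∀ S, ∀ i < l, prodExp (stepProb G) (fun y => x (pushStep S y) (i + 1)) ≤
      2 / 3 * x S (i + 1) + 1 / 3 * x S i := by
    intro S i hi
    by_cases h1 : w (i + 1) ∈ S
    · have : ∀ y, x (pushStep S y) (i + 1) = 0 := fun y => if_pos (Or.inl h1)
      simp only [this, prodExp_const hq]
      have := hx0 S (i + 1)
      have := hx0 S i
      positivity
    · have e1 : x S (i + 1) = 1 := if_neg h1
      rw [e1]
      by_cases h2 : w i ∈ S
      · have hle : ∀ y : Fin n → Fin n, x (pushStep S y) (i + 1) ≤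
            ∏ j ∈ {w i}, if y j = w (i + 1) then 0 else 1 := fun y => by
          rw [Finset.prod_singleton]
          split_ifs with h3
          · exact le_of_eq (if_pos (Or.inr ⟨w i, h2, h3⟩))
          · exact hx1 _ _
        refine (prodExp_mono hq hle).trans ?_
        rw [prodExp_avoid hq {w i} fun _ => w (i + 1), Finset.prod_singleton]
        have := hw i hi
        have := hx0 S i
        linarith
      · have e2 : x S i = 1 := if_neg h2
        refine (prodExp_mono hq fun y => hx1 _ _).trans ?_
        rw [prodExp_const hq, e2]
        norm_num
  have hdec : ∀ S ∈ {S : Set (Fin n) | w 0 ∈ S},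
      prodExp (stepProb G) (fun y => f (pushStep S y)) ≤ 5 / 6 * f S := by
    intro S hS
    have e0 : x S 0 = 0 := if_pos hS
    have h1 : ∑ i ∈ Finset.range l, (1 / 2 : ℝ) ^ (i + 1) * x S i ≤ 1 / 2 * f S := by
      rcases l with _ | l
      · simp [hf]
      · rw [Finset.sum_range_succ', e0, mul_zero, add_zero]
        simp only [hf]
        rw [Finset.sum_range_succ, mul_add, Finset.mul_sum]
        have h3 : ∑ i ∈ Finset.range l, (1 / 2 : ℝ) ^ (i + 1 + 1) * x S (i + 1) =
            ∑ i ∈ Finset.range l, 1 / 2 * ((1 / 2) ^ (i + 1) * x S (i + 1)) :=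
          Finset.sum_congr rfl fun i _ => by ring
        rw [h3]
        have := hx0 S (l + 1)
        have : 0 ≤ (1 / 2 : ℝ) * ((1 / 2) ^ (l + 1) * x S (l + 1)) := by positivity
        linarith
    simp only [hf]
    rw [prodExp_sum]
    calc _ ≤ ∑ i ∈ Finset.range l, (1 / 2 : ℝ) ^ (i + 1) *
          (2 / 3 * x S (i + 1) + 1 / 3 * x S i) := by
          refine Finset.sum_le_sum fun i hi => ?_
          rw [prodExp_const_mul]
          exact mul_le_mul_of_nonneg_left (hone S i (Finset.mem_range.1 hi)) (by positivity)
      _ = 2 / 3 * f S + 1 / 3 * ∑ i ∈ Finset.range l, (1 / 2 : ℝ) ^ (i + 1) * x S i := by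
          simp only [hf, Finset.mul_sum, ← Finset.sum_add_distrib]
          exact Finset.sum_congr rfl fun i _ => by ring
      _ ≤ 5 / 6 * f S := by linarith
  rcases Nat.eq_zero_or_pos l with rfl | hl
  · have : {ω | w 0 ∈ pushInformed s (fun t u => N t u ω) t ∧
        w 0 ∉ pushInformed s (fun t u => N t u ω) (t + k)} = ∅ := by
      ext ω
      simp only [Set.mem_ofPred_eq, Set.mem_empty_iff_false, iff_false, not_and, not_not]
      exact fun h => pushInformed_mono _ _ (Nat.le_add_right t k) h
    rw [this, measureReal_empty]
    positivity
  have hsum : ∑ i ∈ Finset.range l, (1 / 2 : ℝ) ^ (i + 1) ≤ 1 := by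
    have := sum_geometric_two_le l
    simp only [pow_succ]
    rw [← Finset.sum_mul]
    linarith
  have hfM : ∀ S, f S ≤ 1 := fun S => (Finset.sum_le_sum fun i _ =>
    mul_le_of_le_one_right (by positivity) (hx1 S (i + 1))).trans hsum
  have hf0 : ∀ S, 0 ≤ f S := fun S => Finset.sum_nonneg fun i _ =>
    mul_nonneg (by positivity) (hx0 _ _)
  -- The threshold is the weight of the last vertex of the path; its inverse is the factor `2 ^ l`.
  have := h.decay s hf0 (fun S _ => hfM S) zero_le_one (by norm_num)
    (fun S S' hS h => hS h) hdec t k (a := (1 / 2) ^ l) (by positivity)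
  rw [one_mul, one_div, inv_pow, div_inv_eq_mul, mul_comm] at this
  refine le_trans (measureReal_mono ?_) this
  intro ω hω
  refine ⟨hω.1, ?_⟩
  rw [← inv_pow, ← one_div]
  have e1 : x (pushInformed s (fun t u => N t u ω) (t + k)) l = 1 := if_neg hω.2
  calc (1 / 2 : ℝ) ^ l =
        (1 / 2) ^ (l - 1 + 1) * x (pushInformed s (fun t u => N t u ω) (t + k)) (l - 1 + 1) := by
        rw [Nat.sub_add_cancel hl, e1, mul_one]
    _ ≤ _ := Finset.single_le_sum (f := fun i => (1 / 2 : ℝ) ^ (i + 1) *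
        x (pushInformed s (fun t u => N t u ω) (t + k)) (i + 1))
        (fun i _ => mul_nonneg (by positivity) (hx0 _ _)) (Finset.mem_range.2 (by omega))

end Push

/-! ### Ancestor chains -/

namespace BalancedBinaryTree

variable {n : ℕ} {T : BalancedBinaryTree n}

lemma depth_iterate_parent {v : Fin n} {j : ℕ} (hj : j ≤ T.depth v) :
    T.depth (T.parent^[j] v) = T.depth v - j := by
  induction j with
  | zero => rfl
  | succ j ih =>
    have ih := ih (by omega)
    have hne : T.parent^[j] v ≠ T.root := fun h => by
      rw [h, T.depth_root] at ih
      omega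
    have := T.depth_eq _ hne
    rw [Function.iterate_succ_apply']
    omega

lemma iterate_parent_ne_root {v : Fin n} {j : ℕ} (hj : j < T.depth v) :
    T.parent^[j] v ≠ T.root := fun h => by
  have := depth_iterate_parent hj.le
  rw [h, T.depth_root] at this
  omega

lemma iterate_parent_depth (v : Fin n) : T.parent^[T.depth v] v = T.root :=
  eq_root_of_depth (by rw [depth_iterate_parent le_rfl, Nat.sub_self])

end BalancedBinaryTree

/-! ### `push` on the heavy binary tree -/

section PushTree

variable {n : ℕ} {T : BalancedBinaryTree n} {Ω : Type*} [MeasurableSpace Ω] {μ : Measure Ω}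
  [IsProbabilityMeasure μ] {N : ℕ → Fin n → Ω → Fin n}

open BalancedBinaryTree

lemma two_pow_depth_le (v : Fin n) : (2 : ℝ) ^ T.depth v ≤ 2 * n := by
  calc (2 : ℝ) ^ T.depth v ≤ 2 ^ T.height :=
        pow_le_pow_right₀ (by norm_num) (depth_le_height v)
    _ ≤ _ := by exact_mod_cast two_pow_height_le

/-- Every ancestor of an internal vertex is internal, so each sender on the way up has degree at
most 3. A leaf start is excluded because a leaf pushes to its parent only with probability `1 / K`.
-/
lemma push_up (hn : 2 ≤ n) (h : IsNeighborSampling T.heavyGraph μ N) (s : Fin n) {u : Fin n}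
    (hu : ¬ T.IsLeaf u) (t k : ℕ) :
    μ.real {ω | u ∈ pushInformed s (fun t u => N t u ω) t ∧
      T.root ∉ pushInformed s (fun t u => N t u ω) (t + k)} ≤ 2 * n * (5 / 6) ^ k := by
  have hp := h.path s (T.isProbRows hn id) (fun i => T.parent^[i] u) (T.depth u) (fun i hi => by
    have hne := iterate_parent_ne_root hi
    rw [Function.iterate_succ_apply']
    refine internal_one_third_le_stepProb ?_
      (adj_iff.2 ⟨(isChild_parent hne).ne.symm, Or.inr (Or.inl (isChild_parent hne))⟩)
    rcases i with _ | i
    · exact hu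
    · rw [Function.iterate_succ_apply']
      exact not_isLeaf_parent (iterate_parent_ne_root (by omega))) t k
  simp only [iterate_parent_depth, Function.iterate_zero, id_eq] at hp
  refine hp.trans ?_
  gcongr
  exact two_pow_depth_le u

/-- Only proper ancestors of `v` have to push, and these are internal even when `v` is a leaf. -/
lemma push_down (hn : 2 ≤ n) (h : IsNeighborSampling T.heavyGraph μ N) (s v : Fin n) (t k : ℕ) :
    μ.real {ω | T.root ∈ pushInformed s (fun t u => N t u ω) t ∧
      v ∉ pushInformed s (fun t u => N t u ω) (t + k)} ≤ 2 * n * (5 / 6) ^ k := by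
  have hp := h.path s (T.isProbRows hn id) (fun i => T.parent^[T.depth v - i] v) (T.depth v)
    (fun i hi => by
      have hne : T.parent^[T.depth v - (i + 1)] v ≠ T.root := iterate_parent_ne_root (by omega)
      rw [show T.depth v - i = T.depth v - (i + 1) + 1 by omega, Function.iterate_succ_apply']
      exact internal_one_third_le_stepProb (not_isLeaf_parent hne)
        (adj_iff.2 ⟨(isChild_parent hne).ne, Or.inl (isChild_parent hne)⟩)) t k
  simp only [Nat.sub_zero, iterate_parent_depth, Nat.sub_self, Function.iterate_zero, id_eq] at hp
  refine hp.trans ?_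
  gcongr
  exact two_pow_depth_le v

-- Each leaf hits its own parent with probability `1 / K`, so all `K` of them miss with probability
-- `(1 - 1 / K) ^ K ≤ 1 / 2`.
open Classical in
lemma push_leaves_to_internal (hn : 2 ≤ n) (h : IsNeighborSampling T.heavyGraph μ N)
    (s : Fin n) (t k : ℕ) :
    μ.real {ω | (∀ l, T.IsLeaf l → l ∈ pushInformed s (fun t u => N t u ω) t) ∧
      ∀ u ∈ pushInformed s (fun t u => N t u ω) (t + k), T.IsLeaf u} ≤ (1 / 2) ^ k := by
  have hq := T.isProbRows hn id
  have hKn := T.half_le_card_leaves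
  have hK : (1 : ℝ) ≤ T.leaves.card := by
    have : (2 : ℝ) ≤ n := by exact_mod_cast hn
    linarith
  set f : Set (Fin n) → ℝ := fun S => if ∀ u ∈ S, T.IsLeaf u then 1 else 0 with hf
  have hf0 : ∀ S, 0 ≤ f S := fun S => by simp only [hf]; split_ifs <;> norm_num
  have hf1 : ∀ S, f S ≤ 1 := fun S => by simp only [hf]; split_ifs <;> norm_num
  have := h.decay (f := f) (C := {S | ∀ l, T.IsLeaf l → l ∈ S}) (M := 1) (ρ := 1 / 2) s hf0
    (fun S _ => hf1 S) zero_le_one (by norm_num) (fun S S' hS h l hl => hS (h l hl)) ?_ t k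
    (a := 1) one_pos
  · refine le_trans (measureReal_mono ?_) (this.trans (by simp))
    intro ω hω
    refine ⟨hω.1, ?_⟩
    exact (if_pos hω.2).ge
  intro S hS
  by_cases hfS : ∀ u ∈ S, T.IsLeaf u
  · have e1 : f S = 1 := if_pos hfS
    have hle : ∀ y : Fin n → Fin n, f (pushStep S y) ≤
        ∏ j ∈ T.leaves, if y j = T.parent j then 0 else 1 := fun y => by
      rw [prod_ite_zero_one]
      split_ifs with h3
      · obtain ⟨j, hj, hp⟩ := h3
        have hj := mem_leaves.1 hj
        refine le_of_eq (if_neg fun hall => ?_)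
        exact not_isLeaf_parent (hj.ne_root hn)
          (hall (T.parent j) (Or.inr ⟨j, hS j hj, hp⟩))
      · exact hf1 _
    refine (prodExp_mono hq hle).trans ?_
    rw [prodExp_avoid hq, e1, mul_one]
    calc ∏ j ∈ T.leaves, (1 - stepProb T.heavyGraph (id j) (T.parent j)) =
          (1 - 1 / (T.leaves.card : ℝ)) ^ T.leaves.card := by
          rw [← Finset.prod_const]
          refine Finset.prod_congr rfl fun j hj => ?_
          rw [id, (mem_leaves.1 hj).stepProb_parent hn]
      _ ≤ 1 / (1 + T.leaves.card / T.leaves.card) := one_sub_inv_pow_le hK _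
      _ = _ := by rw [div_self (by linarith)]; norm_num
  · have e1 : f S = 0 := if_neg hfS
    have e2 : ∀ y : Fin n → Fin n, f (pushStep S y) = 0 := fun y =>
      if_neg fun hall => hfS fun u hu => hall u (Or.inl hu)
    simp only [e1, e2, mul_zero]
    exact (prodExp_const hq 0).le

open Classical in
/-- The number of informed leaves. -/
noncomputable def informedLeaves (T : BalancedBinaryTree n) (S : Set (Fin n)) : ℕ :=
  (T.leaves.filter (· ∈ S)).card

-- With `I` informed leaves, the expected number `X` of new ones is at least `(K - I) * I / (2 *
-- K)`, and each lowers `K / I` by at least `K / (2 * I ^ 2)`. The product is a quarter of `K / I -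
-- 1`. This single potential covers both the early doubling and the final covering of the clique.
open Classical in
lemma push_leaves_contract (hn : 2 ≤ n) {S : Set (Fin n)} (hS : ∃ l ∈ S, T.IsLeaf l) :
    prodExp (stepProb T.heavyGraph)
      (fun y => (T.leaves.card : ℝ) / informedLeaves T (pushStep S y) - 1) ≤
    3 / 4 * ((T.leaves.card : ℝ) / informedLeaves T S - 1) := by
  have hq := T.isProbRows hn id
  set K : ℝ := (T.leaves.card : ℝ) with hKdef
  set J := T.leaves.filter (· ∈ S) with hJ
  have hI0 : 0 < J.card := by
    obtain ⟨l, hl, hl'⟩ := hS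
    exact Finset.card_pos.2 ⟨l, Finset.mem_filter.2 ⟨mem_leaves.2 hl', hl⟩⟩
  have hIK : J.card ≤ T.leaves.card := Finset.card_filter_le _ _
  set I : ℝ := (J.card : ℝ) with hI
  have hI0' : 0 < I := by rw [hI]; exact_mod_cast hI0
  have hI1 : 1 ≤ I := by rw [hI]; exact_mod_cast hI0
  have hIK' : I ≤ K := by rw [hI, hKdef]; exact_mod_cast hIK
  have hK0 : 0 < K := by linarith
  set R := T.leaves.filter (· ∉ S) with hR
  have hRc : (R.card : ℝ) = K - I := by
    rw [eq_sub_iff_add_eq', hI, hKdef, hR, hJ]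
    exact_mod_cast Finset.card_filter_add_card_filter_not (s := T.leaves) (· ∈ S)
  set X : (Fin n → Fin n) → ℝ := fun y => ∑ v ∈ R, if ∃ u ∈ J, y u = v then 1 else 0 with hX
  have hpt : ∀ y, K / informedLeaves T (pushStep S y) - 1 ≤
      K / I - 1 - K / (2 * I ^ 2) * X y := by
    intro y
    set W := R.filter fun v => ∃ u ∈ J, y u = v with hW
    have hXW : X y = W.card := by
      simp only [hX, hW, Finset.card_filter]
      push_cast
      rfl
    have hXI : X y ≤ I := by
      rw [hXW, hI]
      have : W ⊆ J.image y := fun v hv => by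
        obtain ⟨_, u, hu, huv⟩ := Finset.mem_filter.1 hv
        exact Finset.mem_image.2 ⟨u, hu, huv⟩
      exact_mod_cast (Finset.card_le_card this).trans Finset.card_image_le
    have hX0 : 0 ≤ X y := by rw [hXW]; positivity
    have hI' : I + X y ≤ informedLeaves T (pushStep S y) := by
      rw [hXW, hI]
      have hd : Disjoint J W := by
        rw [Finset.disjoint_left]
        intro v hv hv'
        exact (Finset.mem_filter.1 (Finset.mem_filter.1 hv').1).2 (Finset.mem_filter.1 hv).2
      have : J ∪ W ⊆ T.leaves.filter (· ∈ pushStep S y) := by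
        intro v hv
        rw [Finset.mem_filter]
        rcases Finset.mem_union.1 hv with hv | hv
        · exact ⟨(Finset.mem_filter.1 hv).1, Or.inl (Finset.mem_filter.1 hv).2⟩
        · obtain ⟨hv1, u, hu, huv⟩ := Finset.mem_filter.1 hv
          exact ⟨(Finset.mem_filter.1 hv1).1, Or.inr ⟨u, (Finset.mem_filter.1 hu).2, huv⟩⟩
      have h2 := Finset.card_le_card this
      rw [Finset.card_union_of_disjoint hd] at h2
      unfold informedLeaves
      exact_mod_cast h2
    have h1 : K / informedLeaves T (pushStep S y) ≤ K / (I + X y) := by gcongr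
    -- A linear upper bound for the convex function `K / (I + X)`, valid because `X ≤ I`: every
    -- informed leaf samples only one neighbour.
    have h2 : K / (I + X y) ≤ K / I - K / (2 * I ^ 2) * X y := by
      rw [div_le_iff₀ (by linarith)]
      have : (K / I - K / (2 * I ^ 2) * X y) * (I + X y) =
          K + K * X y * (I - X y) / (2 * I ^ 2) := by field_simp; ring
      rw [this]
      have : 0 ≤ K * X y * (I - X y) / (2 * I ^ 2) :=
        div_nonneg (mul_nonneg (mul_nonneg hK0.le hX0) (by linarith)) (by positivity)
      linarith
    linarith
  have hEX : (K - I) * (I / (2 * K)) ≤ prodExp (stepProb T.heavyGraph) X := by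
    simp only [hX]
    rw [prodExp_sum, ← hRc, ← nsmul_eq_mul]
    refine Finset.card_nsmul_le_sum _ _ _ fun v hv => ?_
    have hvl := mem_leaves.1 (Finset.mem_filter.1 hv).1
    have e1 : (fun y : Fin n → Fin n => if ∃ u ∈ J, y u = v then (1 : ℝ) else 0) =
        fun y => 1 - ∏ u ∈ J, if y u = v then 0 else 1 := by
      funext y
      rw [prod_ite_zero_one]
      split_ifs <;> norm_num
    have e2 := prodExp_avoid hq J fun _ => v
    simp only [id] at e2 hq
    rw [e1, prodExp_sub, prodExp_const hq, e2]
    have e3 : ∏ j ∈ J, (1 - stepProb T.heavyGraph j v) = (1 - 1 / K) ^ J.card := by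
      rw [← Finset.prod_const]
      refine Finset.prod_congr rfl fun j hj => ?_
      rw [(mem_leaves.1 (Finset.mem_filter.1 hj).1).stepProb_leaf hn hvl]
      rintro rfl
      exact (Finset.mem_filter.1 hv).2 (Finset.mem_filter.1 hj).2
    rw [e3]
    have h4 := one_sub_inv_pow_le (K := K) (by linarith) J.card
    have h5 : 1 / (1 + I / K) ≤ 1 - I / (2 * K) := by
      rw [div_le_iff₀ (by positivity)]
      have : (1 - I / (2 * K)) * (1 + I / K) = 1 + I * (K - I) / (2 * K ^ 2) := by
        field_simp; ring
      rw [this]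
      have : 0 ≤ I * (K - I) / (2 * K ^ 2) :=
        div_nonneg (mul_nonneg hI0'.le (by linarith)) (by positivity)
      linarith
    linarith
  have hq' : IsProbRows (stepProb T.heavyGraph) := hq
  refine (prodExp_mono hq' hpt).trans ?_
  rw [prodExp_sub, prodExp_const hq', prodExp_const_mul]
  have h6 : K / (2 * I ^ 2) * ((K - I) * (I / (2 * K))) ≤
      K / (2 * I ^ 2) * prodExp (stepProb T.heavyGraph) X := by gcongr
  have h7 : K / (2 * I ^ 2) * ((K - I) * (I / (2 * K))) = 1 / 4 * (K / I - 1) := by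
    field_simp
    ring
  have h8 : (informedLeaves T S : ℝ) = I := rfl
  rw [h8]
  linarith

-- The potential `K / I - 1` starts at most at `K`, and it is at least `1 / K` while a leaf is
-- missing. Hence the prefactor `K ^ 2 ≤ n ^ 2`.
open Classical in
lemma push_clique (hn : 2 ≤ n) (h : IsNeighborSampling T.heavyGraph μ N)
    (s : Fin n) (t k : ℕ) :
    μ.real {ω | (∃ l ∈ pushInformed s (fun t u => N t u ω) t, T.IsLeaf l) ∧
      ¬ ∀ l, T.IsLeaf l → l ∈ pushInformed s (fun t u => N t u ω) (t + k)} ≤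
      n ^ 2 * (3 / 4) ^ k := by
  set K : ℝ := (T.leaves.card : ℝ) with hKdef
  have hKn : K ≤ n := by
    have := Finset.card_le_univ T.leaves
    rw [Fintype.card_fin] at this
    rw [hKdef]; exact_mod_cast this
  have hK0 : 0 < K := by
    have := T.half_le_card_leaves
    have : (2 : ℝ) ≤ n := by exact_mod_cast hn
    linarith
  set f : Set (Fin n) → ℝ := fun S =>
    if ∃ l ∈ S, T.IsLeaf l then K / informedLeaves T S - 1 else 0 with hf
  have hIpos : ∀ S : Set (Fin n), (∃ l ∈ S, T.IsLeaf l) → (1 : ℝ) ≤ informedLeaves T S := by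
    rintro S ⟨l, hl, hl'⟩
    have : 0 < informedLeaves T S :=
      Finset.card_pos.2 ⟨l, Finset.mem_filter.2 ⟨mem_leaves.2 hl', hl⟩⟩
    exact_mod_cast this
  have hIK : ∀ S, (informedLeaves T S : ℝ) ≤ K := fun S => by
    have : informedLeaves T S ≤ T.leaves.card := Finset.card_filter_le _ _
    rw [hKdef]; exact_mod_cast this
  have hf0 : ∀ S, 0 ≤ f S := fun S => by
    simp only [hf]
    split_ifs with hS
    · have := hIpos S hS
      rw [sub_nonneg, le_div_iff₀ (by linarith)]
      linarith [hIK S]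
    · exact le_rfl
  have := h.decay (f := f) (C := {S | ∃ l ∈ S, T.IsLeaf l}) (M := K) (ρ := 3 / 4) s hf0
    (fun S hS => by
      replace hS : ∃ l ∈ S, T.IsLeaf l := hS
      simp only [hf]
      rw [if_pos hS]
      have : K / informedLeaves T S ≤ K := div_le_self hK0.le (hIpos S hS)
      linarith) hK0.le (by norm_num) (fun S S' hS ⟨l, h1, h2⟩ => ⟨l, hS h1, h2⟩) (fun S hS => by
      replace hS : ∃ l ∈ S, T.IsLeaf l := hS
      have h1 : ∀ y, ∃ l ∈ pushStep S y, T.IsLeaf l := fun y => by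
        obtain ⟨l, h1, h2⟩ := hS
        exact ⟨l, Or.inl h1, h2⟩
      simp only [hf, h1, if_true]
      rw [if_pos hS]
      exact push_leaves_contract hn hS) t k
    (a := 1 / K) (by positivity)
  refine le_trans (measureReal_mono ?_) (this.trans ?_)
  · intro ω hω
    refine ⟨hω.1, ?_⟩
    obtain ⟨⟨l, hl, hl'⟩, hω2⟩ := hω
    have hex : ∃ l ∈ pushInformed s (fun t u => N t u ω) (t + k), T.IsLeaf l :=
      ⟨l, pushInformed_mono _ _ (Nat.le_add_right t k) hl, hl'⟩
    set S := pushInformed s (fun t u => N t u ω) (t + k) with hSdef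
    have hpos := hIpos S hex
    have hlt : (informedLeaves T S : ℝ) + 1 ≤ K := by
      have : informedLeaves T S < T.leaves.card := by
        refine Finset.card_lt_card (Finset.filter_ssubset.2 ?_)
        push Not at hω2
        obtain ⟨l, h1, h2⟩ := hω2
        exact ⟨l, mem_leaves.2 h1, h2⟩
      rw [hKdef]; exact_mod_cast this
    simp only [hf]
    rw [if_pos hex]
    calc 1 / K ≤ 1 / informedLeaves T S := by gcongr; linarith
      _ ≤ (K - informedLeaves T S) / informedLeaves T S := by gcongr; linarith
      _ = _ := by rw [sub_div, div_self (by linarith)]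
  · rw [div_div_eq_mul_div, div_one]
    calc K * (3 / 4) ^ k * K = K ^ 2 * (3 / 4) ^ k := by ring
      _ ≤ _ := by gcongr

/-- The rumor reaches all vertices within `4 k` rounds of `push`, up to an exponentially small
probability. -/
lemma push_bound (hn : 2 ≤ n) (h : IsNeighborSampling T.heavyGraph μ N) (s : Fin n) (k : ℕ) :
    μ.real {ω | pushInformed s (fun t u => N t u ω) (4 * k) ≠ Set.univ} ≤
      6 * n ^ 2 * (5 / 6) ^ k := by
  have hn' : (1 : ℝ) ≤ n := by exact_mod_cast (by omega : 1 ≤ n)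
  set I : Ω → ℕ → Set (Fin n) := fun ω => pushInformed s fun t u => N t u ω with hI
  -- The failures of four consecutive windows of `k` rounds: filling the clique, leaving it for an
  -- internal vertex, reaching the root, reaching each vertex from the root. An internal source
  -- makes the first two windows irrelevant.
  set A := {ω | (∃ l ∈ I ω 0, T.IsLeaf l) ∧ ¬ ∀ l, T.IsLeaf l → l ∈ I ω (0 + k)} with hA
  set B := {ω | (∀ l, T.IsLeaf l → l ∈ I ω k) ∧ ∀ u ∈ I ω (k + k), T.IsLeaf u} with hB
  set D : Fin n → Set Ω := fun u =>
    {ω | ¬ T.IsLeaf u ∧ u ∈ I ω (2 * k) ∧ T.root ∉ I ω (2 * k + k)} with hD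
  set E : Fin n → Set Ω := fun v => {ω | T.root ∈ I ω (3 * k) ∧ v ∉ I ω (3 * k + k)} with hE
  have hsub : {ω | I ω (4 * k) ≠ Set.univ} ⊆ A ∪ B ∪ (⋃ u, D u) ∪ ⋃ v, E v := by
    intro ω hω
    by_contra hcon
    simp only [Set.mem_union, not_or, Set.mem_iUnion, not_exists] at hcon
    obtain ⟨⟨⟨hA', hB'⟩, hD'⟩, hE'⟩ := hcon
    apply hω
    have hs : ∀ t, s ∈ I ω t := source_mem_pushInformed _ _
    have hint : ∃ u ∈ I ω (2 * k), ¬ T.IsLeaf u := by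
      by_cases hsl : T.IsLeaf s
      · have h1 : ∀ l, T.IsLeaf l → l ∈ I ω (0 + k) := by
          by_contra hc
          exact hA' ⟨⟨s, hs 0, hsl⟩, hc⟩
        rw [zero_add] at h1
        by_contra hc
        push Not at hc
        exact hB' ⟨h1, by rwa [← two_mul]⟩
      · exact ⟨s, hs _, hsl⟩
    obtain ⟨u, hu, hul⟩ := hint
    have hroot : T.root ∈ I ω (3 * k) := by
      by_contra hc
      exact hD' u ⟨hul, hu, by rwa [show 2 * k + k = 3 * k by ring]⟩
    refine Set.eq_univ_of_forall fun v => ?_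
    by_contra hc
    exact hE' v ⟨hroot, by rwa [show 3 * k + k = 4 * k by ring]⟩
  have hAb : μ.real A ≤ n ^ 2 * (5 / 6) ^ k := (push_clique hn h s 0 k).trans
    (mul_le_mul_of_nonneg_left (pow_le_pow_left₀ (by norm_num) (by norm_num) k) (by positivity))
  have hBb : μ.real B ≤ (5 / 6) ^ k :=
    (push_leaves_to_internal hn h s k k).trans
      (pow_le_pow_left₀ (by norm_num) (by norm_num) k)
  have hDb : μ.real (⋃ u, D u) ≤ n * (2 * n * (5 / 6) ^ k) := by
    refine (measureReal_iUnion_fintype_le _).trans ?_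
    have : ∀ u ∈ Finset.univ, μ.real (D u) ≤ 2 * n * (5 / 6) ^ k := fun u _ => by
      by_cases hu : T.IsLeaf u
      · have : D u = ∅ := by ext ω; simp [hD, hu]
        rw [this, measureReal_empty]
        positivity
      · exact (measureReal_mono fun ω hω => hω.2).trans (push_up hn h s hu (2 * k) k)
    simpa using Finset.sum_le_card_nsmul _ _ _ this
  have hEb : μ.real (⋃ u, E u) ≤ n * (2 * n * (5 / 6) ^ k) := by
    refine (measureReal_iUnion_fintype_le _).trans ?_
    simpa using Finset.sum_le_card_nsmul _ _ _ fun v (_ : v ∈ Finset.univ) =>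
      push_down hn h s v (3 * k) k
  have h1 := measureReal_mono (μ := μ) hsub
  have h2 := measureReal_union_le (μ := μ) (A ∪ B ∪ ⋃ u, D u) (⋃ v, E v)
  have h3 := measureReal_union_le (μ := μ) (A ∪ B) (⋃ u, D u)
  have h4 := measureReal_union_le (μ := μ) A B
  have h5 : (5 / 6 : ℝ) ^ k ≤ n ^ 2 * (5 / 6) ^ k :=
    le_mul_of_one_le_left (by positivity) (one_le_pow₀ hn')
  linarith

end PushTree

/-! ### Broadcast times -/

lemma firstFull_le {S : Type*} {I : ℕ → Set S} {t : ℕ} (h : I t = Set.univ) :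
    firstFull I ≤ t := iInf₂_le t h

lemma le_firstFull {S : Type*} {I : ℕ → Set S} {t : ℕ} (h : ∀ i < t, I i ≠ Set.univ) :
    (t : ℕ∞) ≤ firstFull I :=
  le_iInf₂ fun i hi => by
    by_contra hlt
    exact h i (by exact_mod_cast not_le.1 hlt) hi

/-- An upper bound for the probability that the process is unfinished at time `t` turns into a
high probability bound for the broadcast time. -/
lemma one_sub_le_measureReal_firstFull {Ω S : Type*} [MeasurableSpace Ω] {μ : Measure Ω}
    [IsProbabilityMeasure μ] {I : Ω → ℕ → Set S} {t : ℕ} {L p : ℝ} (htL : t ≤ L)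
    (h : μ.real {ω | I ω t ≠ Set.univ} ≤ p) :
    1 - p ≤ μ.real {ω | (firstFull (I ω) : ℝ≥0∞) ≤ ENNReal.ofReal L} := by
  have h1 : (Set.univ : Set Ω) ⊆ {ω | (firstFull (I ω) : ℝ≥0∞) ≤ ENNReal.ofReal L} ∪
      {ω | I ω t ≠ Set.univ} := by
    intro ω _
    by_cases hω : I ω t = Set.univ
    · left
      have h2 : (firstFull (I ω) : ℝ≥0∞) ≤ ((t : ℕ∞) : ℝ≥0∞) :=
        ENat.toENNReal_le.2 (firstFull_le hω)
      refine h2.trans ?_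
      rw [ENat.toENNReal_coe, ← ENNReal.ofReal_natCast]
      exact ENNReal.ofReal_le_ofReal htL
    · exact Or.inr hω
  have h2 := measureReal_mono (μ := μ) h1
  have h3 := measureReal_union_le (μ := μ)
    {ω | (firstFull (I ω) : ℝ≥0∞) ≤ ENNReal.ofReal L} {ω | I ω t ≠ Set.univ}
  rw [probReal_univ] at h2
  linarith

lemma exists_pow_le_rpow_neg {ρ : ℝ} (h0 : 0 < ρ) (h1 : ρ < 1) (b : ℝ) :
    ∃ A : ℝ, 0 < A ∧ ∀ n : ℕ, 1 ≤ n → ∀ k : ℕ, A * Real.log n ≤ k → ρ ^ k ≤ (n : ℝ) ^ (-b) := by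
  have hl : 0 < -Real.log ρ := neg_pos.2 (Real.log_neg h0 h1)
  -- Using `|b| + 1` instead of `b` keeps the constant positive for every real `b`.
  refine ⟨(|b| + 1) / (-Real.log ρ), by positivity, fun n hn k hk => ?_⟩
  have hn' : (1 : ℝ) ≤ n := by exact_mod_cast hn
  have hln : 0 ≤ Real.log n := Real.log_nonneg hn'
  rw [← Real.rpow_natCast, Real.rpow_def_of_pos h0, Real.rpow_def_of_pos (by linarith)]
  apply Real.exp_le_exp.2
  have h2 : (|b| + 1) * Real.log n ≤ k * (-Real.log ρ) := by
    rw [div_mul_eq_mul_div, div_le_iff₀ hl] at hk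
    exact hk
  have h3 : b ≤ |b| + 1 := by linarith [le_abs_self b]
  nlinarith

/-! ### Stationary random walks -/

section Walks

variable {n : ℕ} {Ω A : Type*} [MeasurableSpace Ω] {μ : Measure Ω}
  {G : SimpleGraph (Fin n)} {X : A → ℕ → Ω → Fin n}

lemma IsStationaryWalks.isDriven_agent (h : IsStationaryWalks G μ X) (g : A) :
    IsDriven μ (X g) (stepProb G) where
  measurable := h.measurable g
  markov t ξ := by
    rw [h.law, h.law, Finset.prod_range_succ, mul_assoc]

lemma IsStationaryWalks.marginal [IsProbabilityMeasure μ] (h : IsStationaryWalks G μ X) (g : A)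
    (t : ℕ) (v : Fin n) : μ.real {ω | X g t ω = v} = stationaryProb G v := by
  induction t generalizing v with
  | zero => simpa using h.law g 0 fun _ => v
  | succ t ih =>
    have h1 := (h.isDriven_agent g).integral_step (t := t)
      (g := fun _ y => if y = v then (1 : ℝ) else 0) fun _ _ _ => rfl
    have h2 := integral_comp_finite (μ := μ) (h.measurable g (t + 1))
      fun y => if y = v then (1 : ℝ) else 0
    simp only [mul_ite, mul_one, mul_zero, Finset.sum_ite_eq', Finset.mem_univ, if_true] at h1 h2
    rw [h2, integral_comp_finite (h.measurable g t) fun u => stepProb G u v] at h1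
    rw [h1]
    simp only [ih]
    exact sum_stationaryProb_mul_stepProb G v

variable [Fintype A]

lemma IsStationaryWalks.measureReal_forall_agents (h : IsStationaryWalks G μ X)
    (p : A → Set (ℕ → Fin n)) (hp : ∀ g, MeasurableSet (p g)) :
    μ.real {ω | ∀ g, (fun t => X g t ω) ∈ p g} = ∏ g, μ.real {ω | (fun t => X g t ω) ∈ p g} := by
  have h1 := h.indep.measure_inter_preimage_eq_mul Finset.univ (sets := p) fun g _ => hp g
  have h2 : {ω | ∀ g, (fun t => X g t ω) ∈ p g} =
      ⋂ g ∈ (Finset.univ : Finset A), (fun ω t => X g t ω) ⁻¹' p g := by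
    ext ω
    simp
  rw [h2, Measure.real, h1, ENNReal.toReal_prod]
  rfl

lemma measurableSet_path (t : ℕ) (x : ℕ → Fin n) :
    MeasurableSet {p : ℕ → Fin n | ∀ i ≤ t, p i = x i} := by
  have : {p : ℕ → Fin n | ∀ i ≤ t, p i = x i} = ⋂ i, ⋂ _ : i ≤ t, (fun p => p i) ⁻¹' {x i} := by
    ext p
    simp
  rw [this]
  exact MeasurableSet.iInter fun i => MeasurableSet.iInter fun _ =>
    measurable_pi_apply i (measurableSet_singleton _)

/-- By independence, the probability of a joint history is the product over the agents, and each
factor satisfies the one-agent Markov identity. -/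
lemma IsStationaryWalks.isDriven (h : IsStationaryWalks G μ X) :
    IsDriven μ (fun t ω g => X g t ω) fun x y => ∏ g, stepProb G (x g) (y g) where
  measurable t := measurable_pi_lambda _ fun g => h.measurable g t
  markov t ξ := by
    have key : ∀ t, μ.real {ω | ∀ i ≤ t, (fun g => X g i ω) = ξ i} =
        ∏ g, μ.real {ω | ∀ i ≤ t, X g i ω = ξ i g} := fun t => by
      refine Eq.trans ?_ (h.measureReal_forall_agents (fun g => {p | ∀ i ≤ t, p i = ξ i g})
        fun g => measurableSet_path t _)
      congr 1
      ext ω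
      simp only [funext_iff, Set.mem_ofPred_eq]
      exact ⟨fun H g i hi => H i hi g, fun H i hi g => H g i hi⟩
    rw [key, key, ← Finset.prod_mul_distrib]
    exact Finset.prod_congr rfl fun g _ => (h.isDriven_agent g).markov t fun i => ξ i g

lemma IsStationaryWalks.law_positions [IsProbabilityMeasure μ] (h : IsStationaryWalks G μ X)
    (t : ℕ) (y : A → Fin n) :
    μ.real {ω | (fun g => X g t ω) = y} = ∏ g, stationaryProb G (y g) := by
  have h1 := h.measureReal_forall_agents (fun g => {p | p t = y g}) fun g =>
    measurable_pi_apply t (measurableSet_singleton _)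
  simp only [Set.mem_ofPred_eq, h.marginal] at h1
  rw [← h1]
  congr 1
  ext ω
  simp [funext_iff]

end Walks

/-! ### Stationary agents on internal vertices -/

section TreeWalks

variable {n : ℕ} {T : BalancedBinaryTree n} {Ω A : Type*} [MeasurableSpace Ω] {μ : Measure Ω}
  [IsProbabilityMeasure μ]

open BalancedBinaryTree

lemma isProbRows_stationaryProb (hn : 2 ≤ n) :
    IsProbRows fun _ : A => stationaryProb T.heavyGraph where
  nonneg _ v := stationaryProb_nonneg _ v
  sum_eq _ := by
    have h1 := T.sq_card_leaves_le hn
    have h2 := T.half_le_card_leaves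
    have h3 : (2 : ℝ) ≤ n := by exact_mod_cast hn
    have h4 : (0 : ℝ) < 2 * T.heavyGraph.edgeSet.ncard := by nlinarith
    simp only [stationaryProb]
    rw [← Finset.sum_div, sum_ncard_neighborSet, div_self h4.ne']

open Classical in
/-- The number of agents on internal vertices. -/
noncomputable def internalCount (T : BalancedBinaryTree n) {A : Type*} [Fintype A]
    (x : A → Fin n) : ℕ := (Finset.univ.filter fun g => ¬ T.IsLeaf (x g)).card

-- Markov's inequality for `2 ^ count`. At a fixed time the positions are independent and
-- stationary, and each agent is internal with probability at most `12 / n`, so the moment is at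
-- most `(1 + 12 / n) ^ |A| ≤ exp (12 * β)`.
open Classical in
lemma IsStationaryWalks.internalCount_tail [Fintype A] (hn : 2 ≤ n) {X : A → ℕ → Ω → Fin n}
    (h : IsStationaryWalks T.heavyGraph μ X) {β : ℝ} (hA : (Fintype.card A : ℝ) ≤ β * n)
    (t : ℕ) (a : ℝ) :
    μ.real {ω | a ≤ internalCount T fun g => X g t ω} ≤ Real.exp (12 * β) * 2 ^ (-a) := by
  have hn' : (0 : ℝ) < n := by exact_mod_cast (by omega : 0 < n)
  set c : Fin n → ℝ := fun v => if T.IsLeaf v then 1 else 2 with hc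
  have hY : Measurable fun ω (g : A) => X g t ω :=
    measurable_pi_lambda _ fun g => h.measurable g t
  have hcount : ∀ x : A → Fin n, ∏ g, c (x g) = 2 ^ internalCount T x := fun x => by
    simp only [hc, internalCount]
    rw [Finset.prod_ite]
    simp
  have hE : ∫ ω, (2 : ℝ) ^ internalCount T (fun g => X g t ω) ∂μ ≤ Real.exp (12 * β) := by
    rw [integral_comp_finite hY fun x => (2 : ℝ) ^ internalCount T x]
    simp only [h.law_positions, ← hcount]
    have h1 := prodExp_prod (isProbRows_stationaryProb (A := A) (T := T) hn) Finset.univ fun _ => c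
    unfold prodExp at h1
    rw [h1, Finset.prod_const, Finset.card_univ]
    have h2 : ∑ v, stationaryProb T.heavyGraph v * c v ≤ 1 + 12 / n := by
      have h3 : ∀ v, stationaryProb T.heavyGraph v * c v ≤
          stationaryProb T.heavyGraph v + 12 / (n : ℝ) ^ 2 := fun v => by
        simp only [hc]
        split_ifs with hv
        · have : 0 ≤ 12 / (n : ℝ) ^ 2 := by positivity
          linarith
        · linarith [T.stationaryProb_internal_le hn hv]
      refine (Finset.sum_le_sum fun v _ => h3 v).trans ?_
      rw [Finset.sum_add_distrib, (isProbRows_stationaryProb (A := Unit) (T := T) hn).sum_eq (),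
        Finset.sum_const, Finset.card_univ, Fintype.card_fin, nsmul_eq_mul]
      apply le_of_eq
      field_simp
    have h4 : 0 ≤ ∑ v, stationaryProb T.heavyGraph v * c v :=
      Finset.sum_nonneg fun v _ => mul_nonneg (stationaryProb_nonneg _ _)
        (by simp only [hc]; split_ifs <;> norm_num)
    calc (∑ v, stationaryProb T.heavyGraph v * c v) ^ Fintype.card A
        ≤ (1 + 12 / n) ^ Fintype.card A := pow_le_pow_left₀ h4 h2 _
      _ ≤ Real.exp (12 / n) ^ Fintype.card A := by
          refine pow_le_pow_left₀ (by positivity) ?_ _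
          linarith [Real.add_one_le_exp (12 / (n : ℝ))]
      _ = Real.exp (Fintype.card A * (12 / n)) := (Real.exp_nat_mul _ _).symm
      _ ≤ _ := by
          apply Real.exp_le_exp.2
          calc (Fintype.card A : ℝ) * (12 / n) ≤ β * n * (12 / n) := by gcongr
            _ = _ := by field_simp
  have hint : Integrable (fun ω => (2 : ℝ) ^ internalCount T fun g => X g t ω) μ :=
    (Integrable.of_finite (f := fun x => (2 : ℝ) ^ internalCount T x)).comp_measurable hY
  have hm := mul_meas_ge_le_integral_of_nonneg (μ := μ)
    (Filter.Eventually.of_forall fun ω => by positivity) hint ((2 : ℝ) ^ a)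
  have h2a : (0 : ℝ) < 2 ^ a := Real.rpow_pos_of_pos two_pos a
  rw [Real.rpow_neg two_pos.le, ← div_eq_mul_inv, le_div_iff₀ h2a, mul_comm]
  refine le_trans (mul_le_mul_of_nonneg_left (measureReal_mono fun ω hω => ?_) h2a.le)
    (hm.trans hE)
  simp only [Set.mem_ofPred_eq] at hω ⊢
  rw [← Real.rpow_natCast]
  exact Real.rpow_le_rpow_of_exponent_le (by norm_num) hω

/-! ### `visit-exchange` -/

omit [MeasurableSpace Ω] in
lemma exists_visit_of_mem_visitInformed {V : Type*} {s v : V} {X : A → ℕ → V} {t : ℕ}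
    (h : v ∈ (visitInformed s X t).1) (hv : v ≠ s) : ∃ g, ∃ i ≤ t, X g i = v := by
  induction t with
  | zero => exact (hv h).elim
  | succ t ih =>
    rcases h with h | ⟨g, _, hg⟩
    · obtain ⟨g, i, hi, hg⟩ := ih h
      exact ⟨g, i, by omega, hg⟩
    · exact ⟨g, t + 1, le_rfl, hg⟩

lemma exists_internal_ne (hn : 4 ≤ n) (s : Fin n) : ∃ v, v ≠ s ∧ ¬ T.IsLeaf v := by
  by_contra hcon
  push Not at hcon
  have h1 : Finset.univ.erase s ⊆ T.leaves := fun v hv =>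
    mem_leaves.2 (hcon v (Finset.ne_of_mem_erase hv))
  have h2 := Finset.card_le_card h1
  rw [Finset.card_erase_of_mem (Finset.mem_univ s), Finset.card_univ, Fintype.card_fin,
    card_leaves_eq] at h2
  omega

/-- By stationarity each of the `m * (t + 1)` pairs of an agent and a round hits a fixed internal
vertex with probability at most `12 / n ^ 2`. Unless some pair does, that vertex is uninformed
through round `t` and the broadcast time is at least `t + 1`. -/
lemma visitx_lower_bound {m : ℕ} (hn : 4 ≤ n) (s : Fin n) {X : Fin m → ℕ → Ω → Fin n}
    (h : IsStationaryWalks T.heavyGraph μ X) (t : ℕ)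
    (ht : (m : ℝ) * (t + 1) * (12 / (n : ℝ) ^ 2) ≤ 1 / 2) :
    ENNReal.ofReal ((t + 1) / 2) ≤ ∫⁻ ω, (Tvisitx s (fun g t => X g t ω) : ℝ≥0∞) ∂μ := by
  obtain ⟨v, hvs, hv⟩ := exists_internal_ne (T := T) hn s
  set B : Set Ω := ⋃ p ∈ (Finset.univ : Finset (Fin m)) ×ˢ Finset.range (t + 1),
    {ω | X p.1 p.2 ω = v} with hB
  have hBm : MeasurableSet B := Finset.measurableSet_biUnion _ fun p _ =>
    h.measurable p.1 p.2 (measurableSet_singleton v)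
  have hBr : μ.real B ≤ 1 / 2 := by
    refine (measureReal_biUnion_finset_le _ _).trans (le_trans ?_ ht)
    simp only [h.marginal]
    rw [Finset.sum_const, Finset.card_product, Finset.card_univ, Fintype.card_fin,
      Finset.card_range, nsmul_eq_mul]
    push_cast
    gcongr
    exact T.stationaryProb_internal_le (by omega) hv
  have hBc : 1 / 2 ≤ μ.real Bᶜ := by
    rw [probReal_compl_eq_one_sub hBm]
    linarith
  have hT : ∀ ω ∈ Bᶜ, ((t + 1 : ℕ) : ℝ≥0∞) ≤ (Tvisitx s (fun g t => X g t ω) : ℝ≥0∞) := by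
    intro ω hω
    rw [← ENat.toENNReal_coe, ENat.toENNReal_le]
    refine le_firstFull fun i hi hfull => hω ?_
    obtain ⟨g, j, hj, hg⟩ := exists_visit_of_mem_visitInformed
      (s := s) (X := fun g t => X g t ω) (t := i) (v := v)
      (by rw [hfull]; exact Set.mem_univ v) hvs
    simp only [hB, Set.mem_iUnion]
    exact ⟨(g, j), by simp; omega, hg⟩
  calc ENNReal.ofReal ((t + 1) / 2) ≤ ENNReal.ofReal ((t + 1 : ℕ) * μ.real Bᶜ) := by
        apply ENNReal.ofReal_le_ofReal
        push_cast
        nlinarith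
    _ = (t + 1 : ℕ) * μ Bᶜ := by
        rw [ENNReal.ofReal_mul (by positivity), ENNReal.ofReal_natCast, ofReal_measureReal]
    _ = ∫⁻ _ω in Bᶜ, ((t + 1 : ℕ) : ℝ≥0∞) ∂μ := by rw [setLIntegral_const]
    _ ≤ ∫⁻ ω in Bᶜ, (Tvisitx s (fun g t => X g t ω) : ℝ≥0∞) ∂μ :=
        setLIntegral_mono' hBm.compl hT
    _ ≤ _ := setLIntegral_le_lintegral _ _

end TreeWalks

open BalancedBinaryTree

/-! ### Meetings in one step -/

section Landing

variable {n : ℕ} {T : BalancedBinaryTree n} {A : Type*} [Fintype A] [DecidableEq A]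

lemma prodExp_land_avoid {V : Type*} [Fintype V] [DecidableEq V] {q : A → V → ℝ}
    (hq : IsProbRows q) {i : A} {R : Finset A} (hi : i ∉ R) (v : V) :
    prodExp q (fun y => (if y i = v then 1 else 0) * ∏ j ∈ R, if y j = v then 0 else 1) =
      q i v * ∏ j ∈ R, (1 - q j v) := by
  have h1 := prodExp_prod hq (insert i R) fun k w =>
    if k = i then (if w = v then 1 else 0) else (if w = v then 0 else 1)
  have h2 : ∀ k ∈ R, k ≠ i := fun k hk h => hi (h ▸ hk)
  simp only [Finset.prod_insert hi, if_true] at h1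
  have h3 : ∀ y : A → V, (∏ k ∈ R, if k = i then (if y k = v then (1 : ℝ) else 0)
      else (if y k = v then 0 else 1)) = ∏ k ∈ R, if y k = v then 0 else 1 := fun y =>
    Finset.prod_congr rfl fun k hk => if_neg (h2 k hk)
  simp only [h3] at h1
  rw [h1]
  congr 1
  · simp
  · refine Finset.prod_congr rfl fun k hk => ?_
    simp only [if_neg (h2 k hk)]
    exact sum_mul_ite_ne hq k v

open Classical in
/-- An agent on a leaf is likely to step to a leaf to which no agent of the small set `J` and some
agent of the large set `U` steps. -/
lemma landing_prob (hn : 2 ≤ n) (x : A → Fin n) {i : A} {J U : Finset A} (hi : T.IsLeaf (x i))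
    (hiJ : i ∉ J) (hiU : i ∉ U) (hJU : Disjoint J U) (hJ : ∀ j ∈ J, T.IsLeaf (x j))
    (hU : ∀ u ∈ U, T.IsLeaf (x u)) {c : ℝ} (hc : 0 ≤ c) (hK : 4 ≤ (T.leaves.card : ℝ))
    (hJc : (J.card : ℝ) ≤ T.leaves.card / 2) (hUc : c * T.leaves.card ≤ U.card) :
    c / (4 * (2 + c)) ≤ prodExp (fun g => stepProb T.heavyGraph (x g)) (fun y =>
      if T.IsLeaf (y i) ∧ (∀ j ∈ J, y j ≠ y i) ∧ ∃ u ∈ U, y u = y i then 1 else 0) := by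
  have hq := T.isProbRows hn x
  set K : ℝ := (T.leaves.card : ℝ) with hKdef
  have hK0 : 0 < K := by linarith
  -- Agents on `v` cannot step to `v`, so a leaf that holds more than half of `U` is discarded as a
  -- meeting place. Two such leaves cannot exist.
  set B := T.leaves.filter fun v => U.card < 2 * (U.filter fun u => x u = v).card with hB
  have hBc : B.card ≤ 1 := by
    rw [Finset.card_le_one]
    intro v hv w hw
    by_contra hvw
    have h1 := (Finset.mem_filter.1 hv).2
    have h2 := (Finset.mem_filter.1 hw).2
    have hd : Disjoint (U.filter fun u => x u = v) (U.filter fun u => x u = w) := by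
      rw [Finset.disjoint_filter]
      exact fun u _ h3 h4 => hvw (h3.symm.trans h4)
    have h3 := Finset.card_le_card
      (Finset.union_subset (Finset.filter_subset (fun u => x u = v) U)
        (Finset.filter_subset (fun u => x u = w) U))
    rw [Finset.card_union_of_disjoint hd] at h3
    omega
  set R := (T.leaves.erase (x i)) \ B with hR
  have hRc : K - 2 ≤ R.card := by
    have h1 : _ ≤ R.card := Finset.le_card_sdiff B (T.leaves.erase (x i))
    have h2 := Finset.card_erase_add_one (mem_leaves.2 hi)
    have h3 : T.leaves.card ≤ R.card + 2 := by omega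
    have h4 : K ≤ (R.card : ℝ) + 2 := by rw [hKdef]; exact_mod_cast h3
    linarith
  -- For each landing leaf, the event that `J` misses it and `U` hits it is written as a difference
  -- of two avoidance events, whose probabilities are products.
  have hpt : ∀ y : A → Fin n, ∑ v ∈ R,
      ((if y i = v then (1 : ℝ) else 0) * (∏ j ∈ J, if y j = v then 0 else 1) -
        (if y i = v then 1 else 0) * ∏ j ∈ J ∪ U, if y j = v then 0 else 1) ≤
      if T.IsLeaf (y i) ∧ (∀ j ∈ J, y j ≠ y i) ∧ ∃ u ∈ U, y u = y i then 1 else 0 := by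
    intro y
    have h1 : ∀ v ∈ R,
        ((if y i = v then (1 : ℝ) else 0) * (∏ j ∈ J, if y j = v then 0 else 1) -
        (if y i = v then 1 else 0) * ∏ j ∈ J ∪ U, if y j = v then 0 else 1) =
        if v = y i then ((∏ j ∈ J, if y j = y i then 0 else 1) -
          ∏ j ∈ J ∪ U, if y j = y i then 0 else 1) else 0 := fun v _ => by
      by_cases hv : v = y i
      · subst hv; simp
      · simp [hv, Ne.symm hv]
    rw [Finset.sum_congr rfl h1, Finset.sum_ite_eq']
    by_cases hyR : y i ∈ R
    · rw [if_pos hyR, prod_ite_zero_one, prod_ite_zero_one]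
      have hl : T.IsLeaf (y i) :=
        mem_leaves.1 (Finset.mem_of_mem_erase (Finset.mem_sdiff.1 hyR).1)
      by_cases h2 : ∃ j ∈ J, y j = y i
      · rw [if_pos h2]
        split_ifs <;> norm_num
      · rw [if_neg h2]
        by_cases h3 : ∃ u ∈ U, y u = y i
        · push Not at h2
          rw [if_pos (show T.IsLeaf (y i) ∧ (∀ j ∈ J, y j ≠ y i) ∧ ∃ u ∈ U, y u = y i from
            ⟨hl, h2, h3⟩)]
          split_ifs <;> norm_num
        · have h4 : ¬ ∃ j ∈ J ∪ U, y j = y i := by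
            rintro ⟨j, hj, hji⟩
            rcases Finset.mem_union.1 hj with hj | hj
            exacts [h2 ⟨j, hj, hji⟩, h3 ⟨j, hj, hji⟩]
          rw [if_neg h4, sub_self]
          split_ifs <;> norm_num
    · rw [if_neg hyR]
      split_ifs <;> norm_num
  refine le_trans ?_ (prodExp_mono hq hpt)
  rw [prodExp_sum]
  have hiJU : i ∉ J ∪ U := by simp [hiJ, hiU]
  have h1K : 0 ≤ 1 - 1 / K := by
    rw [sub_nonneg, div_le_one hK0]
    linarith
  have hterm : ∀ v ∈ R, 1 / K * (1 / 2 * (c / (2 + c))) ≤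
      prodExp (fun g => stepProb T.heavyGraph (x g)) (fun y =>
        ((if y i = v then (1 : ℝ) else 0) * (∏ j ∈ J, if y j = v then 0 else 1) -
        (if y i = v then 1 else 0) * ∏ j ∈ J ∪ U, if y j = v then 0 else 1)) := by
    intro v hv
    obtain ⟨hv1, hv2⟩ := Finset.mem_sdiff.1 hv
    have hvl := mem_leaves.1 (Finset.mem_of_mem_erase hv1)
    rw [prodExp_sub, prodExp_land_avoid hq hiJ, prodExp_land_avoid hq hiJU,
      Finset.prod_union hJU, hi.stepProb_leaf hn hvl (Finset.ne_of_mem_erase hv1)]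
    have hPJ : 1 / 2 ≤ ∏ j ∈ J, (1 - stepProb T.heavyGraph (x j) v) := by
      calc (1 / 2 : ℝ) ≤ 1 + J.card * (-(1 / K)) := by
            have : (J.card : ℝ) * (1 / K) ≤ 1 / 2 := by
              rw [mul_one_div, div_le_iff₀ hK0]
              linarith
            linarith
        _ ≤ (1 + -(1 / K)) ^ J.card := one_add_mul_le_pow (by linarith) _
        _ = ∏ j ∈ J, (1 + -(1 / K)) := by rw [Finset.prod_const]
        _ ≤ _ := by
            refine Finset.prod_le_prod (fun j _ => by linarith) fun j hj => ?_
            have := (hJ j hj).stepProb_le hn v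
            linarith
    have hPU : ∏ u ∈ U, (1 - stepProb T.heavyGraph (x u) v) ≤ 1 / (1 + c / 2) := by
      set U' := U.filter fun u => ¬ x u = v with hU'
      have hU'c : c / 2 ≤ U'.card / K := by
        have h2 : ¬ U.card < 2 * (U.filter fun u => x u = v).card := fun h =>
          hv2 (Finset.mem_filter.2 ⟨mem_leaves.2 hvl, h⟩)
        have h3 : _ + U'.card = U.card :=
          Finset.card_filter_add_card_filter_not (s := U) fun u => x u = v
        have h4 : U.card ≤ 2 * U'.card := by omega
        have h5 : (U.card : ℝ) ≤ 2 * U'.card := by exact_mod_cast h4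
        rw [le_div_iff₀ hK0]
        linarith
      rw [← Finset.prod_filter_mul_prod_filter_not U fun u => x u = v]
      calc _ ≤ 1 * ∏ u ∈ U', (1 - 1 / K) := by
            refine mul_le_mul (Finset.prod_le_one (fun u _ => ?_) fun u _ => ?_)
              (Finset.prod_le_prod (fun u _ => ?_) fun u hu => ?_)
              (Finset.prod_nonneg fun u _ => ?_) zero_le_one
            · linarith [hq.le_one u v]
            · linarith [hq.nonneg u v]
            · linarith [hq.le_one u v]
            · obtain ⟨hu1, hu2⟩ := Finset.mem_filter.1 hu
              rw [(hU u hu1).stepProb_leaf hn hvl (Ne.symm hu2)]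
            · linarith [hq.le_one u v]
        _ = (1 - 1 / K) ^ U'.card := by rw [one_mul, Finset.prod_const]
        _ ≤ 1 / (1 + U'.card / K) := one_sub_inv_pow_le (by linarith) _
        _ ≤ _ := by gcongr
    have h6 : c / (2 + c) ≤ 1 - ∏ u ∈ U, (1 - stepProb T.heavyGraph (x u) v) := by
      have : c / (2 + c) = 1 - 1 / (1 + c / 2) := by field_simp; ring
      linarith
    calc 1 / K * (1 / 2 * (c / (2 + c))) ≤ 1 / K *
          ((∏ j ∈ J, (1 - stepProb T.heavyGraph (x j) v)) *
            (1 - ∏ u ∈ U, (1 - stepProb T.heavyGraph (x u) v))) := by gcongr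
      _ = _ := by ring
  -- The factors: 1/2 for landing outside the at most two excluded leaves (`K ≥ 4`), 1/2 for being
  -- missed by `J`, and `c / (2 + c)` for being hit by `U`.
  calc c / (4 * (2 + c)) = (1 / 2) * (1 / 2 * (c / (2 + c))) := by field_simp; norm_num
    _ ≤ ((K - 2) / K) * (1 / 2 * (c / (2 + c))) := by
        refine mul_le_mul_of_nonneg_right ?_ (by positivity)
        rw [le_div_iff₀ hK0]
        linarith
    _ = (K - 2) * (1 / K * (1 / 2 * (c / (2 + c)))) := by ring
    _ ≤ R.card * (1 / K * (1 / 2 * (c / (2 + c)))) := by gcongr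
    _ = R.card • (1 / K * (1 / 2 * (c / (2 + c)))) := (nsmul_eq_mul _ _).symm
    _ ≤ _ := Finset.card_nsmul_le_sum _ _ _ hterm

end Landing

/-! ### One round of `meet-exchange` -/

section MeetStep

variable {n : ℕ} {T : BalancedBinaryTree n} {A : Type*}

/-- The informed agents after a round of `meet-exchange` in which the agents move to `y`. -/
def meetStep {V : Type*} (s : V) (y : A → V) (I : Set A) : Set A :=
  I ∪ {g | ∃ h ∈ I, y g = y h} ∪ {g | I = ∅ ∧ y g = s}

lemma subset_meetStep {V : Type*} (s : V) (y : A → V) (I : Set A) : I ⊆ meetStep s y I :=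
  fun _ h => Or.inl (Or.inl h)

lemma mem_meetStep_of_meet {V : Type*} {s : V} {y : A → V} {I : Set A} {g h : A} (hh : h ∈ I)
    (hg : y g = y h) : g ∈ meetStep s y I := Or.inl (Or.inr ⟨h, hh, hg⟩)

variable [Fintype A]

open Classical in
/-- A set of agents as a finite set. -/
noncomputable def agentFinset (I : Set A) : Finset A := Finset.univ.filter (· ∈ I)

@[simp] lemma mem_agentFinset {I : Set A} {g : A} : g ∈ agentFinset I ↔ g ∈ I := by
  simp [agentFinset]

lemma agentFinset_mono {I I' : Set A} (h : I ⊆ I') : agentFinset I ⊆ agentFinset I' :=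
  fun _ hg => mem_agentFinset.2 (h (mem_agentFinset.1 hg))

/-- The total weight of the informed agents. -/
noncomputable def weight (T : BalancedBinaryTree n) (x : A → Fin n) (I : Set A) : ℝ :=
  ∑ g ∈ agentFinset I, 1 / T.potential (x g)

lemma potential_pos (v : Fin n) : 0 < T.potential v := one_pos.trans_le (one_le_potential v)

lemma weight_pos {x : A → Fin n} {I : Set A} (hI : I.Nonempty) : 0 < weight T x I := by
  obtain ⟨g, hg⟩ := hI
  exact Finset.sum_pos (fun _ _ => one_div_pos.2 (potential_pos _)) ⟨g, mem_agentFinset.2 hg⟩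

lemma weight_le_card (x : A → Fin n) (I : Set A) : weight T x I ≤ (agentFinset I).card := by
  have := Finset.sum_le_card_nsmul (agentFinset I) (fun g => 1 / T.potential (x g)) 1
    fun _ _ => by
      rw [div_le_one (potential_pos _)]
      exact one_le_potential _
  simpa [weight] using this

lemma one_div_weight_le (x : A → Fin n) {I : Set A} (hI : I.Nonempty) :
    1 / weight T x I ≤ 4 * n := by
  obtain ⟨g, hg⟩ := hI
  have h1 : 1 / T.potential (x g) ≤ weight T x I :=
    Finset.single_le_sum (f := fun g => 1 / T.potential (x g))
      (fun g _ => (one_div_pos.2 (potential_pos _)).le) (mem_agentFinset.2 hg)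
  calc 1 / weight T x I ≤ 1 / (1 / T.potential (x g)) :=
        one_div_le_one_div_of_le (one_div_pos.2 (potential_pos _)) h1
    _ = T.potential (x g) := by rw [one_div_one_div]
    _ ≤ _ := potential_le _

variable [DecidableEq A]

open Classical in
/-- Every informed agent that meets an uninformed one at a leaf which no other informed agent of
`J` reaches accounts for one more unit of weight. -/
lemma sum_add_le_weight_meetStep (s : Fin n) (y : A → Fin n) {I : Set A} {J U : Finset A}
    (hU : ∀ u ∈ U, u ∉ I) :
    ∑ i ∈ agentFinset I, (1 / T.potential (y i) +
      if i ∈ J ∧ T.IsLeaf (y i) ∧ (∀ j ∈ J.erase i, y j ≠ y i) ∧ ∃ u ∈ U, y u = y i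
        then 1 else 0) ≤ weight T y (meetStep s y I) := by
  set B := (agentFinset I).filter fun i =>
    i ∈ J ∧ T.IsLeaf (y i) ∧ (∀ j ∈ J.erase i, y j ≠ y i) ∧ ∃ u ∈ U, y u = y i with hB
  have hex : ∀ i ∈ B, ∃ u ∈ U, y u = y i := fun i hi => (Finset.mem_filter.1 hi).2.2.2.2
  choose! u huU huy using hex
  -- Two successful agents never share a partner: they would stand on the same leaf, but a
  -- successful agent is the only one of `J` on its leaf. New agents are thus counted once.
  have hinj : Set.InjOn u B := by
    intro i hi j hj hij
    by_contra hne
    have h1 := (Finset.mem_filter.1 hi).2.2.2.1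
    have h2 := (Finset.mem_filter.1 hj).2.1
    refine h1 j (Finset.mem_erase.2 ⟨Ne.symm hne, h2⟩) ?_
    rw [← huy i hi, ← huy j hj, hij]
  have hd : Disjoint (agentFinset I) (B.image u) := by
    rw [Finset.disjoint_left]
    intro g hg hg'
    obtain ⟨i, hi, rfl⟩ := Finset.mem_image.1 hg'
    exact hU _ (huU i hi) (mem_agentFinset.1 hg)
  have hsub : agentFinset I ∪ B.image u ⊆ agentFinset (meetStep s y I) := by
    refine Finset.union_subset (agentFinset_mono (subset_meetStep s y I)) fun g hg => ?_
    obtain ⟨i, hi, rfl⟩ := Finset.mem_image.1 hg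
    exact mem_agentFinset.2
      (mem_meetStep_of_meet (mem_agentFinset.1 (Finset.mem_filter.1 hi).1) (huy i hi))
  have himg : ∑ g ∈ B.image u, 1 / T.potential (y g) = B.card := by
    rw [Finset.sum_image hinj]
    have : ∀ i ∈ B, 1 / T.potential (y (u i)) = 1 := fun i hi => by
      rw [huy i hi, potential_of_isLeaf (Finset.mem_filter.1 hi).2.2.1, div_one]
    rw [Finset.sum_congr rfl this]
    simp
  calc _ = ∑ i ∈ agentFinset I, 1 / T.potential (y i) + B.card := by
        rw [Finset.sum_add_distrib, hB, Finset.card_filter]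
        push_cast
        rfl
    _ = ∑ g ∈ agentFinset I ∪ B.image u, 1 / T.potential (y g) := by
        rw [Finset.sum_union hd, himg]
    _ ≤ _ := Finset.sum_le_sum_of_subset_of_nonneg hsub fun g _ _ =>
        (one_div_pos.2 (potential_pos _)).le

omit [DecidableEq A] in
open Classical in
lemma card_le_card_leaf_agents (x : A → Fin n) (I : Finset A) :
    (I.card : ℝ) - internalCount T x ≤ (I.filter fun g => T.IsLeaf (x g)).card := by
  have h1 := Finset.card_filter_add_card_filter_not (s := I) fun g => T.IsLeaf (x g)
  have h2 : (I.filter fun g => ¬ T.IsLeaf (x g)).card ≤ internalCount T x :=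
    Finset.card_le_card (Finset.filter_subset_filter _ (Finset.subset_univ I))
  have h3 : I.card ≤ (I.filter fun g => T.IsLeaf (x g)).card + internalCount T x := by omega
  have h4 : (I.card : ℝ) ≤ (I.filter fun g => T.IsLeaf (x g)).card + internalCount T x := by
    exact_mod_cast h3
  linarith

variable {κ : ℝ}

-- At least `κ * n / 2` agents are on leaves, and each steps to the leaf `s` with probability `1 /
-- K`. Agents already on `s` must be ruled out, as they cannot stay there.
open Classical in
lemma meet_start_contract (hn : 2 ≤ n) {s : Fin n} (hs : T.IsLeaf s) (hκ : 0 < κ)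
    (hA : 4 * κ * n ≤ Fintype.card A) {x : A → Fin n} (hx : ∀ g, x g ≠ s)
    (hgood : (internalCount T x : ℝ) ≤ κ * n / 2) :
    prodExp (fun g => stepProb T.heavyGraph (x g))
      (fun y => if meetStep s y ∅ = ∅ then 1 else 0) ≤ 1 / (1 + κ / 2) := by
  have hq := T.isProbRows hn x
  have hn' : (2 : ℝ) ≤ n := by exact_mod_cast hn
  have hK2 := T.half_le_card_leaves
  have hKn : (T.leaves.card : ℝ) ≤ n := by
    have := Finset.card_le_univ T.leaves
    rw [Fintype.card_fin] at this
    exact_mod_cast this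
  have hK1 : (1 : ℝ) ≤ T.leaves.card := by linarith
  set J := Finset.univ.filter fun g => T.IsLeaf (x g) with hJ
  have hJc := card_le_card_leaf_agents (T := T) x Finset.univ
  rw [Finset.card_univ] at hJc
  have hle : ∀ y : A → Fin n, (if meetStep s y ∅ = ∅ then (1 : ℝ) else 0) ≤
      ∏ j ∈ J, if y j = s then 0 else 1 := fun y => by
    rw [prod_ite_zero_one]
    by_cases h : ∃ j ∈ J, y j = s
    · obtain ⟨j, _, hj⟩ := h
      have : meetStep s y ∅ ≠ ∅ := Set.Nonempty.ne_empty ⟨j, Or.inr ⟨rfl, hj⟩⟩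
      rw [if_neg this]
      split_ifs <;> norm_num
    · rw [if_neg h]
      split_ifs <;> norm_num
  refine (prodExp_mono hq hle).trans ?_
  rw [prodExp_avoid hq J fun _ => s]
  calc ∏ j ∈ J, (1 - stepProb T.heavyGraph (x j) s) = (1 - 1 / (T.leaves.card : ℝ)) ^ J.card := by
        rw [← Finset.prod_const]
        refine Finset.prod_congr rfl fun j hj => ?_
        rw [(Finset.mem_filter.1 hj).2.stepProb_leaf hn hs (hx j).symm]
    _ ≤ 1 / (1 + J.card / T.leaves.card) := one_sub_inv_pow_le hK1 _
    _ ≤ _ := by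
        refine one_div_le_one_div_of_le (by positivity) (add_le_add_right ?_ 1)
        rw [le_div_iff₀ (by linarith)]
        have : κ / 2 * T.leaves.card ≤ κ / 2 * n := by gcongr
        have : 0 < κ * n := by positivity
        linarith

-- The reciprocal weight is made linear in the potentials of single agents: with `w i` the old
-- weights and `r i` lower bounds for the new ones, `1 / ∑ r i ≤ (∑ w i ^ 2 / r i) / W ^ 2`. It then
-- suffices to contract the expectation for each agent separately: off the leaves by the Lyapunov
-- drift, on the leaves by the chance of informing a new agent.
open Classical in
lemma meet_growth_contract (hn : 2 ≤ n) (s : Fin n) (hκ : 0 < κ) (hκ1 : κ ≤ 1 / 4)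
    (hA : 4 * κ * n ≤ Fintype.card A) (hK : 4 ≤ (T.leaves.card : ℝ)) {δ : ℝ}
    (hδ : δ = κ / 2 / (4 * (2 + κ / 2))) (hKδ : 16 / (T.leaves.card : ℝ) ≤ δ) {x : A → Fin n}
    (hgood : (internalCount T x : ℝ) ≤ κ * n / 2) {I : Set A} (hI : I.Nonempty)
    (hIc : ((agentFinset I).card : ℝ) ≤ κ * n) :
    prodExp (fun g => stepProb T.heavyGraph (x g))
      (fun y => 1 / weight T y (meetStep s y I)) ≤ (1 - δ / 18) * (1 / weight T x I) := by
  have hq := T.isProbRows hn x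
  have hn' : (2 : ℝ) ≤ n := by exact_mod_cast hn
  have hK2 := T.half_le_card_leaves
  have hKn : (T.leaves.card : ℝ) ≤ n := by
    have := Finset.card_le_univ T.leaves
    rw [Fintype.card_fin] at this
    exact_mod_cast this
  have hκn : 0 < κ * n := by positivity
  have hδ0 : 0 < δ := by rw [hδ]; positivity
  have hδ1 : δ ≤ 1 := by
    rw [hδ, div_le_one (by positivity)]
    linarith
  set J := (agentFinset I).filter fun g => T.IsLeaf (x g) with hJ
  set U := (agentFinset I)ᶜ.filter fun g => T.IsLeaf (x g) with hU
  have hJI : ∀ j ∈ J, j ∈ I := fun j hj => mem_agentFinset.1 (Finset.mem_filter.1 hj).1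
  have hUI : ∀ u ∈ U, u ∉ I := fun u hu h =>
    Finset.mem_compl.1 (Finset.mem_filter.1 hu).1 (mem_agentFinset.2 h)
  have hJc : (J.card : ℝ) ≤ T.leaves.card / 2 := by
    have h1 : (J.card : ℝ) ≤ (agentFinset I).card := by
      exact_mod_cast Finset.card_filter_le (agentFinset I) fun g => T.IsLeaf (x g)
    have h2 : κ * n ≤ 1 / 4 * n := by gcongr
    linarith
  have hUc : κ / 2 * T.leaves.card ≤ U.card := by
    have h1 := card_le_card_leaf_agents (T := T) x (agentFinset I)ᶜ
    have h2 : ((agentFinset I)ᶜ.card : ℝ) = Fintype.card A - (agentFinset I).card := by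
      rw [Finset.card_compl, Nat.cast_sub (Finset.card_le_univ _)]
    have h3 : κ / 2 * T.leaves.card ≤ κ / 2 * n := by gcongr
    rw [h2] at h1
    linarith
  set E : A → (A → Fin n) → Prop := fun i y =>
    T.IsLeaf (y i) ∧ (∀ j ∈ J.erase i, y j ≠ y i) ∧ ∃ u ∈ U, y u = y i with hE
  set W := weight T x I with hW
  have hW0 : 0 < W := weight_pos hI
  set w : A → ℝ := fun i => 1 / T.potential (x i) with hw
  have hpt : ∀ y, 1 / weight T y (meetStep s y I) ≤
      1 / W ^ 2 * ∑ i ∈ agentFinset I, w i ^ 2 *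
        (T.potential (y i) - 1 / 2 * if i ∈ J ∧ E i y then 1 else 0) := by
    intro y
    set r : A → ℝ := fun i => 1 / T.potential (y i) + if i ∈ J ∧ E i y then 1 else 0 with hr
    have hr0 : ∀ i ∈ agentFinset I, 0 < r i := fun i _ => by
      have := one_div_pos.2 (potential_pos (T := T) (y i))
      simp only [hr]
      split_ifs <;> linarith
    have h1 : ∑ i ∈ agentFinset I, r i ≤ weight T y (meetStep s y I) :=
      sum_add_le_weight_meetStep s y hUI
    have h2 : 0 < ∑ i ∈ agentFinset I, r i := by
      obtain ⟨g, hg⟩ := hI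
      exact Finset.sum_pos hr0 ⟨g, mem_agentFinset.2 hg⟩
    have h3 := Finset.sq_sum_div_le_sum_sq_div (agentFinset I) w hr0
    have h4 : ∑ i ∈ agentFinset I, w i = W := rfl
    rw [h4] at h3
    -- A successful agent stands on a leaf, where `r i = 2` and `1 / r i = 1 - 1 / 2`.
    have h5 : ∑ i ∈ agentFinset I, w i ^ 2 / r i ≤ ∑ i ∈ agentFinset I, w i ^ 2 *
        (T.potential (y i) - 1 / 2 * if i ∈ J ∧ E i y then 1 else 0) := by
      refine Finset.sum_le_sum fun i _ => ?_
      rw [div_eq_mul_inv]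
      refine mul_le_mul_of_nonneg_left ?_ (sq_nonneg _)
      simp only [hr]
      split_ifs with hiE
      · rw [potential_of_isLeaf hiE.2.1]
        norm_num
      · simp
    calc 1 / weight T y (meetStep s y I) ≤ 1 / ∑ i ∈ agentFinset I, r i :=
          one_div_le_one_div_of_le h2 h1
      _ = 1 / W ^ 2 * (W ^ 2 / ∑ i ∈ agentFinset I, r i) := by field_simp
      _ ≤ _ := by gcongr; exact h3.trans h5
  refine (prodExp_mono hq hpt).trans ?_
  rw [prodExp_const_mul, prodExp_sum]
  have hterm : ∀ i ∈ agentFinset I, prodExp (fun g => stepProb T.heavyGraph (x g))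
      (fun y => w i ^ 2 * (T.potential (y i) - 1 / 2 * if i ∈ J ∧ E i y then 1 else 0)) ≤
      (1 - δ / 18) * w i := by
    intro i hi
    rw [prodExp_const_mul, prodExp_sub, prodExp_const_mul, prodExp_coord hq i T.potential]
    have hφ := potential_pos (T := T) (x i)
    have hmain : ∑ v, stepProb T.heavyGraph (x i) v * T.potential v -
        1 / 2 * prodExp (fun g => stepProb T.heavyGraph (x g))
          (fun y => if i ∈ J ∧ E i y then 1 else 0) ≤ (1 - δ / 18) * T.potential (x i) := by
      by_cases hl : T.IsLeaf (x i)
      · have hiJ : i ∈ J := Finset.mem_filter.2 ⟨hi, hl⟩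
        simp only [hiJ, true_and]
        have h1 := sum_stepProb_mul_potential_leaf hn hl
        have h2 := landing_prob hn x (i := i) (J := J.erase i) (U := U) (c := κ / 2) hl
          (Finset.notMem_erase i J) (fun h => hUI i h (mem_agentFinset.1 hi))
          (Finset.disjoint_left.2 fun j hj hj' => hUI j hj' (hJI j (Finset.mem_of_mem_erase hj)))
          (fun j hj => (Finset.mem_filter.1 (Finset.mem_of_mem_erase hj)).2)
          (fun u hu => (Finset.mem_filter.1 hu).2) (by positivity) hK
          (le_trans (by exact_mod_cast Finset.card_erase_le) hJc) hUc
        rw [← hδ] at h2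
        rw [potential_of_isLeaf hl]
        -- The escape cost `4 / K` is at most `δ / 4`, against a gain of `δ / 2`. The remaining
        -- factor `1 - δ / 4` is below `1 - δ / 18`, a rate that, since `δ ≤ 1`, also covers `17 /
        -- 18` off the leaves.
        have h3 : 4 / (T.leaves.card : ℝ) = 16 / T.leaves.card / 4 := by ring
        linarith
      · have h1 := sum_stepProb_mul_potential_internal hl
        have h2 : 0 ≤ prodExp (fun g => stepProb T.heavyGraph (x g))
            (fun y => if i ∈ J ∧ E i y then (1 : ℝ) else 0) := by
          refine (prodExp_const hq 0).ge.trans (prodExp_mono hq fun y => ?_)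
          split_ifs <;> norm_num
        nlinarith
    calc _ ≤ w i ^ 2 * ((1 - δ / 18) * T.potential (x i)) := by gcongr
      _ = _ := by simp only [hw]; field_simp
  calc _ ≤ 1 / W ^ 2 * ∑ i ∈ agentFinset I, (1 - δ / 18) * w i := by
        gcongr with i hi
        exact hterm i hi
    _ = 1 / W ^ 2 * ((1 - δ / 18) * W) := by rw [← Finset.mul_sum]; rfl
    _ = _ := by field_simp

-- The potential of `g` drops to 0 when `g` is informed. On a leaf this happens with probability at
-- least `δ`, by `landing_prob` with nobody to avoid and the informed leaf agents as targets;
-- elsewhere the drift towards the leaves suffices.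
open Classical in
lemma meet_finish_contract (hn : 2 ≤ n) (s : Fin n) (hκ : 0 < κ)
    (hK : 4 ≤ (T.leaves.card : ℝ)) {δ : ℝ}
    (hδ : δ = κ / 2 / (4 * (2 + κ / 2))) (hKδ : 16 / (T.leaves.card : ℝ) ≤ δ) {x : A → Fin n}
    (hgood : (internalCount T x : ℝ) ≤ κ * n / 2) {I : Set A}
    (hIc : κ * n < (agentFinset I).card) (g : A) :
    prodExp (fun g => stepProb T.heavyGraph (x g))
      (fun y => if g ∈ meetStep s y I then 0 else T.potential (y g)) ≤
        (1 - δ / 18) * (if g ∈ I then 0 else T.potential (x g)) := by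
  have hq := T.isProbRows hn x
  by_cases hg : g ∈ I
  · have : ∀ y, g ∈ meetStep s y I := fun y => subset_meetStep s y I hg
    simp only [this, if_true, hg, mul_zero]
    exact (prodExp_const hq 0).le
  rw [if_neg hg]
  have hKn : (T.leaves.card : ℝ) ≤ n := by
    have := Finset.card_le_univ T.leaves
    rw [Fintype.card_fin] at this
    exact_mod_cast this
  have hδ0 : 0 < δ := by rw [hδ]; positivity
  have hδ1 : δ ≤ 1 := by
    rw [hδ, div_le_one (by positivity)]
    linarith
  have hφ := potential_pos (T := T) (x g)
  by_cases hl : T.IsLeaf (x g)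
  · set J := (agentFinset I).filter fun g => T.IsLeaf (x g) with hJ
    have hJc : κ / 2 * T.leaves.card ≤ J.card := by
      have h1 := card_le_card_leaf_agents (T := T) x (agentFinset I)
      have h3 : κ / 2 * T.leaves.card ≤ κ / 2 * n := by gcongr
      linarith
    have hpt : ∀ y : A → Fin n, (if g ∈ meetStep s y I then 0 else T.potential (y g)) ≤
        T.potential (y g) - if T.IsLeaf (y g) ∧ (∀ j ∈ (∅ : Finset A), y j ≠ y g) ∧
          ∃ u ∈ J, y u = y g then 1 else 0 := fun y => by
      by_cases hE : T.IsLeaf (y g) ∧ (∀ j ∈ (∅ : Finset A), y j ≠ y g) ∧ ∃ u ∈ J, y u = y g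
      · obtain ⟨u, hu, huy⟩ := hE.2.2
        rw [if_pos hE, if_pos (mem_meetStep_of_meet
          (mem_agentFinset.1 (Finset.mem_filter.1 hu).1) huy.symm)]
        linarith [one_le_potential (T := T) (y g)]
      · rw [if_neg hE, sub_zero]
        split_ifs
        · exact (potential_pos _).le
        · exact le_rfl
    refine (prodExp_mono hq hpt).trans ?_
    rw [prodExp_sub, prodExp_coord hq g T.potential]
    have h1 := sum_stepProb_mul_potential_leaf hn hl
    have h2 := landing_prob hn x (i := g) (J := ∅) (U := J) (c := κ / 2) hl
      (Finset.notMem_empty g) (fun h => hg (mem_agentFinset.1 (Finset.mem_filter.1 h).1))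
      (Finset.disjoint_empty_left _) (fun j hj => (Finset.notMem_empty j hj).elim)
      (fun u hu => (Finset.mem_filter.1 hu).2) (by positivity) hK
      (by rw [Finset.card_empty, Nat.cast_zero]; linarith) hJc
    rw [← hδ] at h2
    rw [potential_of_isLeaf hl]
    have h3 : 4 / (T.leaves.card : ℝ) = 16 / T.leaves.card / 4 := by ring
    linarith
  · have hpt : ∀ y : A → Fin n, (if g ∈ meetStep s y I then 0 else T.potential (y g)) ≤
        T.potential (y g) := fun y => by
      split_ifs
      · exact (potential_pos _).le
      · exact le_rfl
    refine (prodExp_mono hq hpt).trans ?_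
    rw [prodExp_coord hq g T.potential]
    have h1 := sum_stepProb_mul_potential_internal hl
    nlinarith

end MeetStep

/-! ### `meet-exchange` -/

section Meet

variable {n : ℕ} {T : BalancedBinaryTree n} {A : Type*} {Ω : Type*}

lemma meetInformed_determinedAt {V : Type*} (s : V) (X : A → ℕ → Ω → V) (t : ℕ) :
    DeterminedAt (fun t ω g => X g t ω) t fun ω => meetInformed s (fun g t => X g t ω) t := by
  induction t with
  | zero =>
    intro ω ω' h
    have h2 := fun g => congrFun (h 0 le_rfl) g
    simp only [meetInformed] at h2 ⊢
    simp only [h2]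
  | succ t ih =>
    intro ω ω' h
    have h1 := ih ω ω' fun i hi => h i (by omega)
    have h2 := fun g => congrFun (h (t + 1) le_rfl) g
    simp only [meetInformed] at h1 h2 ⊢
    rw [h1]
    simp only [h2]

variable [MeasurableSpace Ω] {μ : Measure Ω} [IsProbabilityMeasure μ] [Fintype A]
  {X : A → ℕ → Ω → Fin n}

open Classical in
lemma IsStationaryWalks.meet_decay (h : IsStationaryWalks T.heavyGraph μ X) (s : Fin n)
    {f : (A → Fin n) × Set A → ℝ} {C G : Set ((A → Fin n) × Set A)} {M ρ : ℝ}
    (hf : ∀ z, 0 ≤ f z) (hM : ∀ z ∈ C, f z ≤ M) (hM0 : 0 ≤ M) (hρ : 0 ≤ ρ)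
    (hC : ∀ x I y, (x, I) ∈ C → (y, meetStep s y I) ∈ C)
    (hdec : ∀ x I, (x, I) ∈ C → (x, I) ∈ G →
      prodExp (fun g => stepProb T.heavyGraph (x g)) (fun y => f (y, meetStep s y I)) ≤
        ρ * f (x, I))
    (t k : ℕ) {a : ℝ} (ha : 0 < a) :
    μ.real {ω | ((fun g => X g t ω), meetInformed s (fun g t => X g t ω) t) ∈ C ∧
      (∀ i < t + k, ((fun g => X g i ω), meetInformed s (fun g t => X g t ω) i) ∈ G) ∧
      a ≤ f ((fun g => X g (t + k) ω), meetInformed s (fun g t => X g t ω) (t + k))} ≤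
      M * ρ ^ k / a :=
  h.isDriven.measureReal_le_of_contracting
    (Z := fun t ω => ((fun g => X g t ω), meetInformed s (fun g t => X g t ω) t))
    (F := fun z y => (y, meetStep s y z.2))
    (fun t ω ω' hω => Prod.ext (hω t le_rfl) (meetInformed_determinedAt s X t ω ω' hω))
    (fun _ _ => rfl) hf hM hM0 hρ (fun z y => hC z.1 z.2 y)
    (fun _ _ h1 h2 => hdec _ _ h1 h2) t k ha

open Classical in
/-- All agents are informed within `3 k` rounds of `meet-exchange`, up to the probability that too
many agents sit on internal vertices and an exponentially small one. -/
lemma meet_bound (hn : 2 ≤ n) {s : Fin n} (hs : T.IsLeaf s)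
    (h : IsStationaryWalks T.heavyGraph μ X) {κ β δ : ℝ} (hκ : 0 < κ) (hκ1 : κ ≤ 1 / 4)
    (hA : 4 * κ * n ≤ Fintype.card A) (hAβ : (Fintype.card A : ℝ) ≤ β * n)
    (hK : 4 ≤ (T.leaves.card : ℝ)) (hδ : δ = κ / 2 / (4 * (2 + κ / 2)))
    (hKδ : 16 / (T.leaves.card : ℝ) ≤ δ) (k : ℕ) :
    μ.real {ω | meetInformed s (fun g t => X g t ω) (3 * k) ≠ Set.univ} ≤
      3 * k * (Real.exp (12 * β) * 2 ^ (-(κ * n / 2))) +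
        (5 + 4 * β) * n ^ 2 * (1 - δ / 18) ^ k := by
  have hn' : (1 : ℝ) ≤ n := by exact_mod_cast (by omega : 1 ≤ n)
  have hδ0 : 0 < δ := by rw [hδ]; positivity
  have hδ1 : δ ≤ 1 := by
    rw [hδ, div_le_one (by positivity)]
    linarith
  set ρ : ℝ := 1 - δ / 18 with hρ
  have hρ0 : 0 ≤ ρ := by linarith
  have hκn : 0 < κ * n := by positivity
  have hκn1 : κ * n ≤ n := by nlinarith
  have hβ : 0 ≤ β := by nlinarith
  set I : Ω → ℕ → Set A := fun ω => meetInformed s fun g t => X g t ω with hI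
  have hImono : ∀ ω, Monotone (I ω) := fun ω => monotone_nat_of_le_succ fun t =>
    subset_meetStep s (fun g => X g (t + 1) ω) (I ω t)
  set G : Set ((A → Fin n) × Set A) := {z | (internalCount T z.1 : ℝ) ≤ κ * n / 2} with hG
  set good : ℕ → Set Ω := fun t => {ω | ∀ i < t, ((fun g => X g i ω), I ω i) ∈ G} with hgood
  have hgood_mono : ∀ {t t'}, t ≤ t' → good t' ⊆ good t := fun htt ω hω i hi =>
    hω i (hi.trans_le htt)
  set B0 : Set Ω := ⋃ t ∈ Finset.range (3 * k),
    {ω | κ * n / 2 ≤ internalCount T fun g => X g t ω} with hB0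
  have hB0b : μ.real B0 ≤ 3 * k * (Real.exp (12 * β) * 2 ^ (-(κ * n / 2))) := by
    refine (measureReal_biUnion_finset_le _ _).trans ?_
    have := Finset.sum_le_card_nsmul (Finset.range (3 * k))
      (fun t => μ.real {ω | κ * n / 2 ≤ internalCount T fun g => X g t ω}) _
      fun t _ => h.internalCount_tail hn hAβ t (κ * n / 2)
    refine this.trans (le_of_eq ?_)
    rw [Finset.card_range, nsmul_eq_mul]
    push_cast
    rfl
  -- no agent has visited the source
  set B1 : Set Ω := {ω | ω ∈ good k ∧ I ω k = ∅} with hB1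
  have hB1b : μ.real B1 ≤ ρ ^ k := by
    -- The invariant says that nobody stands on `s` while no agent is informed. It holds at round 0
    -- and is what `meet_start_contract` needs.
    have := h.meet_decay s (f := fun z => if z.2 = ∅ then 1 else 0)
      (C := {z | z.2 = ∅ → ∀ g, z.1 g ≠ s}) (G := G) (M := 1) (ρ := ρ)
      (fun z => by split_ifs <;> norm_num) (fun z _ => by split_ifs <;> norm_num) zero_le_one hρ0
      (fun x J y _ hJ g hg => by
        have hJ0 : J = ∅ := Set.subset_empty_iff.1 (hJ ▸ subset_meetStep s y J)
        have : g ∈ meetStep s y J := Or.inr ⟨hJ0, hg⟩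
        rw [show meetStep s y J = ∅ from hJ] at this
        exact this)
      (fun x J hC hGx => by
        by_cases hJ : J = ∅
        · subst hJ
          simp only [if_true, mul_one]
          refine (meet_start_contract hn hs hκ hA (hC rfl) hGx).trans ?_
          rw [hρ, hδ, div_le_iff₀ (by positivity)]
          have : (1 - κ / 2 / (4 * (2 + κ / 2)) / 18) * (1 + κ / 2) =
              1 + κ / 2 * (1 - (1 + κ / 2) / (72 * (2 + κ / 2))) := by
            field_simp
            ring
          rw [this]
          have : (1 + κ / 2) / (72 * (2 + κ / 2)) ≤ 1 := by
            rw [div_le_one (by positivity)]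
            linarith
          have : 0 ≤ κ / 2 * (1 - (1 + κ / 2) / (72 * (2 + κ / 2))) :=
            mul_nonneg (by linarith) (by linarith)
          linarith
        · have : ∀ y, meetStep s y J ≠ ∅ := fun y hy =>
            hJ (Set.subset_empty_iff.1 (hy ▸ subset_meetStep s y J))
          simp only [this, hJ, if_false, mul_zero]
          exact (prodExp_const (T.isProbRows hn x) 0).le) 0 k (a := 1) one_pos
    rw [one_mul, div_one] at this
    refine le_trans (measureReal_mono ?_) this
    rintro ω ⟨hω1, hω2⟩
    refine ⟨fun h0 g hg => ?_, by rw [zero_add]; exact hω1, ?_⟩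
    · have : g ∈ I ω 0 := hg
      rw [show I ω 0 = ∅ from h0] at this
      exact this
    · rw [zero_add]
      exact (if_pos hω2).ge
  -- few agents are informed
  set B2 : Set Ω := {ω | (I ω k).Nonempty ∧ ω ∈ good (k + k) ∧
    ((agentFinset (I ω (k + k))).card : ℝ) ≤ κ * n} with hB2
  have hB2b : μ.real B2 ≤ 4 * n ^ 2 * ρ ^ k := by
    -- The reciprocal weight is at most `4 * n` once someone is informed, and at least `1 / n` while
    -- at most `κ * n ≤ n` agents are. It is set to 0 beyond that size, which is never undone.
    have := h.meet_decay s
      (f := fun z => if z.2.Nonempty ∧ ((agentFinset z.2).card : ℝ) ≤ κ * n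
        then 1 / weight T z.1 z.2 else 0)
      (C := {z | z.2.Nonempty}) (G := G) (M := 4 * n) (ρ := ρ)
      (fun z => by
        split_ifs with hz
        · exact (one_div_pos.2 (weight_pos hz.1)).le
        · exact le_rfl)
      (fun z hz => by
        split_ifs
        · exact one_div_weight_le z.1 hz
        · positivity) (by positivity) hρ0
      (fun x J y hJ => hJ.mono (subset_meetStep s y J))
      (fun x J hC hGx => by
        have hC : J.Nonempty := hC
        by_cases hJ : ((agentFinset J).card : ℝ) ≤ κ * n
        · rw [if_pos (And.intro hC hJ)]
          refine (prodExp_mono (T.isProbRows hn x) fun y => ?_).trans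
            (meet_growth_contract hn s hκ hκ1 hA hK hδ hKδ hGx hC hJ)
          dsimp only
          split_ifs
          · exact le_rfl
          · exact (one_div_pos.2 (weight_pos (hC.mono (subset_meetStep s y J)))).le
        · have : ∀ y, ¬ ((meetStep s y J).Nonempty ∧
              ((agentFinset (meetStep s y J)).card : ℝ) ≤ κ * n) := fun y hy => by
            refine hJ (le_trans ?_ hy.2)
            exact_mod_cast Finset.card_le_card (agentFinset_mono (subset_meetStep s y J))
          simp only [this, hJ, and_false, if_false, mul_zero]
          exact (prodExp_const (T.isProbRows hn x) 0).le) k k (a := 1 / n) (by positivity)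
    rw [div_div_eq_mul_div, div_one] at this
    refine le_trans (measureReal_mono ?_) (this.trans (le_of_eq (by ring)))
    rintro ω ⟨hω1, hω2, hω3⟩
    have hne : (I ω (k + k)).Nonempty := hω1.mono (hImono ω (Nat.le_add_right k k))
    refine ⟨hω1, hω2, ?_⟩
    dsimp only
    rw [if_pos (And.intro hne hω3)]
    exact one_div_le_one_div_of_le (weight_pos hne)
      ((weight_le_card _ _).trans (hω3.trans hκn1))
  -- some agent remains uninformed
  set B3 : A → Set Ω := fun g => {ω | κ * n < (agentFinset (I ω (2 * k))).card ∧
    ω ∈ good (2 * k + k) ∧ g ∉ I ω (2 * k + k)} with hB3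
  have hB3b : ∀ g, μ.real (B3 g) ≤ 4 * n * ρ ^ k := fun g => by
    have := h.meet_decay s (f := fun z => if g ∈ z.2 then 0 else T.potential (z.1 g))
      (C := {z | κ * n < (agentFinset z.2).card}) (G := G) (M := 4 * n) (ρ := ρ)
      (fun z => by
        split_ifs
        · exact le_rfl
        · exact (potential_pos _).le)
      (fun z _ => by
        split_ifs
        · positivity
        · exact potential_le _) (by positivity) hρ0
      (fun x J y (hJ : κ * n < (agentFinset J).card) => hJ.trans_le (by
        exact_mod_cast Finset.card_le_card (agentFinset_mono (subset_meetStep s y J))))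
      (fun x J hC hGx => meet_finish_contract hn s hκ hK hδ hKδ hGx hC g) (2 * k) k
      (a := 1) one_pos
    rw [div_one] at this
    refine le_trans (measureReal_mono ?_) this
    rintro ω ⟨hω1, hω2, hω3⟩
    refine ⟨hω1, hω2, ?_⟩
    dsimp only
    rw [if_neg hω3]
    exact one_le_potential _
  have hB3u : μ.real (⋃ g, B3 g) ≤ β * n * (4 * n * ρ ^ k) := by
    refine (measureReal_iUnion_fintype_le _).trans ?_
    refine (Finset.sum_le_card_nsmul _ _ _ fun g _ => hB3b g).trans ?_
    rw [Finset.card_univ, nsmul_eq_mul]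
    gcongr
  -- Three windows of `k` rounds: first informed agent, more than `κ * n` informed agents, all
  -- agents. `B0` covers the rounds with too many agents on internal vertices.
  have hsub : {ω | I ω (3 * k) ≠ Set.univ} ⊆ B0 ∪ B1 ∪ B2 ∪ ⋃ g, B3 g := by
    intro ω hω
    by_contra hcon
    simp only [Set.mem_union, not_or, Set.mem_iUnion, not_exists] at hcon
    obtain ⟨⟨⟨h0, h1⟩, h2⟩, h3⟩ := hcon
    have hg : ω ∈ good (3 * k) := fun i hi => by
      by_contra hc
      refine h0 (Set.mem_biUnion (Finset.mem_coe.2 (Finset.mem_range.2 hi)) ?_)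
      exact (not_le.1 (show ¬ (internalCount T (fun g => X g i ω) : ℝ) ≤ κ * n / 2 from hc)).le
    have h1' : (I ω k).Nonempty := by
      rw [Set.nonempty_iff_ne_empty]
      exact fun hc => h1 ⟨hgood_mono (by omega) hg, hc⟩
    have h2' : κ * n < (agentFinset (I ω (2 * k))).card := by
      by_contra hc
      rw [two_mul] at hc
      exact h2 ⟨h1', hgood_mono (by omega) hg, not_lt.1 hc⟩
    refine hω (Set.eq_univ_of_forall fun g => ?_)
    by_contra hc
    exact h3 g ⟨h2', hgood_mono (by omega) hg, by rwa [show 2 * k + k = 3 * k by ring]⟩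
  have e1 := measureReal_mono (μ := μ) hsub
  have e2 := measureReal_union_le (μ := μ) (B0 ∪ B1 ∪ B2) (⋃ g, B3 g)
  have e3 := measureReal_union_le (μ := μ) (B0 ∪ B1) B2
  have e4 := measureReal_union_le (μ := μ) B0 B1
  have e5 : ρ ^ k ≤ n ^ 2 * ρ ^ k :=
    le_mul_of_one_le_left (by positivity) (one_le_pow₀ hn')
  have e6 : (5 + 4 * β) * n ^ 2 * ρ ^ k = n ^ 2 * ρ ^ k + 4 * n ^ 2 * ρ ^ k +
    β * n * (4 * n * ρ ^ k) := by ring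
  linarith

end Meet

/-! ### The three protocols on the heavy binary tree -/

lemma one_le_log_of_three_le {n : ℕ} (hn : 3 ≤ n) : 1 ≤ Real.log n := by
  have hn' : (3 : ℝ) ≤ n := by exact_mod_cast hn
  rw [Real.le_log_iff_exp_le (by linarith)]
  linarith [Real.exp_one_lt_d9]

lemma natCeil_mul_log_le {A : ℝ} (hA : 0 < A) {n : ℕ} (hn : 3 ≤ n) :
    (⌈A * Real.log n⌉₊ : ℝ) ≤ (A + 1) * Real.log n := by
  have h1 := one_le_log_of_three_le hn
  have h2 := Nat.ceil_lt_add_one (a := A * Real.log n) (by positivity)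
  linarith

theorem push_logarithmic (lam : ℝ) : ∃ C : ℝ, 0 < C ∧ ∃ n₀ : ℕ, ∀ n : ℕ, n₀ ≤ n →
    ∀ (T : BalancedBinaryTree n) (s : Fin n)
      (Ω : Type*) [MeasurableSpace Ω] (μ : Measure Ω) [IsProbabilityMeasure μ]
      (N : ℕ → Fin n → Ω → Fin n), IsNeighborSampling T.heavyGraph μ N →
      1 - (n : ℝ) ^ (-lam) ≤
        μ.real {ω | (Tpush s (fun t u => N t u ω) : ℝ≥0∞) ≤ ENNReal.ofReal (C * Real.log n)} := by
  -- The exponent exceeds `lam` by 3: two powers pay for `n ^ 2` in `push_bound` and one absorbs the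
  -- constant 6.
  obtain ⟨A, hA, hdec⟩ := exists_pow_le_rpow_neg (ρ := 5 / 6) (by norm_num) (by norm_num) (lam + 3)
  refine ⟨4 * (A + 1), by positivity, 6, fun n hn T s Ω _ μ _ N h => ?_⟩
  have hn6 : (6 : ℝ) ≤ n := by exact_mod_cast hn
  have hn0 : (0 : ℝ) < n := by linarith
  set k := ⌈A * Real.log n⌉₊ with hk
  have hp := hdec n (by omega) k (Nat.le_ceil _)
  refine one_sub_le_measureReal_firstFull (t := 4 * k)
    (I := fun ω => pushInformed s fun t u => N t u ω) ?_
    ((push_bound (by omega) h s k).trans ?_)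
  · push_cast
    have := natCeil_mul_log_le hA (n := n) (by omega)
    linarith
  · calc 6 * (n : ℝ) ^ 2 * (5 / 6) ^ k ≤ n * (n : ℝ) ^ 2 * (n : ℝ) ^ (-(lam + 3)) := by gcongr
      _ = (n : ℝ) ^ (3 : ℝ) * (n : ℝ) ^ (-(lam + 3)) := by
          rw [show (3 : ℝ) = (3 : ℕ) by norm_num, Real.rpow_natCast]
          ring
      _ = (n : ℝ) ^ (-lam) := by
          rw [← Real.rpow_add hn0]
          congr 1
          ring

theorem visitx_linear (α β : ℝ) (hα : 0 < α) (hαβ : α ≤ β) : ∃ c : ℝ, 0 < c ∧ ∃ n₀ : ℕ,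
    ∀ n : ℕ, n₀ ≤ n → ∀ (T : BalancedBinaryTree n) (s : Fin n)
      (m : ℕ), α * n ≤ m → (m : ℝ) ≤ β * n →
    ∀ (Ω : Type*) [MeasurableSpace Ω] (μ : Measure Ω) [IsProbabilityMeasure μ]
      (X : Fin m → ℕ → Ω → Fin n), IsStationaryWalks T.heavyGraph μ X →
      ENNReal.ofReal (c * n) ≤ ∫⁻ ω, (Tvisitx s (fun g t => X g t ω) : ℝ≥0∞) ∂μ := by
  have hβ : 0 < β := hα.trans_le hαβ
  -- With `t = ⌊n / (48 * β)⌋` and `n ≥ 48 * β`, the number `t + 1` is at most `2 * n / (48 * β)`,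
  -- which makes the union bound exactly 1/2. The expectation is at least half of `n / (48 * β)`.
  refine ⟨1 / (96 * β), by positivity, max 4 ⌈48 * β⌉₊, fun n hn T s m _ hm Ω _ μ _ X h => ?_⟩
  have hn4 : 4 ≤ n := (le_max_left _ _).trans hn
  have hn48 : 48 * β ≤ n := Nat.ceil_le.1 ((le_max_right _ _).trans hn)
  have hn0 : (0 : ℝ) < n := by exact_mod_cast (by omega : 0 < n)
  set t := ⌊n / (48 * β)⌋₊ with ht
  have ht1 : (t : ℝ) ≤ n / (48 * β) := Nat.floor_le (by positivity)
  have ht2 : n / (48 * β) < t + 1 := Nat.lt_floor_add_one _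
  refine le_trans (ENNReal.ofReal_le_ofReal ?_) (visitx_lower_bound hn4 s h t ?_)
  · have : 1 / (96 * β) * n = n / (48 * β) / 2 := by field_simp; norm_num
    linarith
  · have h1 : 1 ≤ n / (48 * β) := by rw [le_div_iff₀ (by positivity)]; linarith
    calc (m : ℝ) * (t + 1) * (12 / (n : ℝ) ^ 2)
        ≤ (β * n) * (n / (48 * β) + n / (48 * β)) * (12 / (n : ℝ) ^ 2) := by gcongr
      _ = 1 / 2 := by field_simp; norm_num

theorem meetx_logarithmic (α β : ℝ) (hα : 0 < α) (hαβ : α ≤ β) (lam : ℝ) :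
    ∃ C : ℝ, 0 < C ∧ ∃ n₀ : ℕ, ∀ n : ℕ, n₀ ≤ n →
    ∀ (T : BalancedBinaryTree n) (s : Fin n), T.IsLeaf s →
    ∀ (m : ℕ), α * n ≤ m → (m : ℝ) ≤ β * n →
    ∀ (Ω : Type*) [MeasurableSpace Ω] (μ : Measure Ω) [IsProbabilityMeasure μ]
      (X : Fin m → ℕ → Ω → Fin n), IsStationaryWalks T.heavyGraph μ X →
      1 - (n : ℝ) ^ (-lam) ≤
        μ.real {ω | (Tmeetx s (fun g t => X g t ω) : ℝ≥0∞) ≤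
          ENNReal.ofReal (C * Real.log n)} := by
  have hβ : 0 < β := hα.trans_le hαβ
  -- The bound `4 * κ ≤ α` leaves enough uninformed agents during growth, and `κ ≤ 1 / 4` keeps the
  -- informed ones at most half as many as the leaves.
  obtain ⟨κ, hκ⟩ : ∃ κ, κ = min α 1 / 4 := ⟨_, rfl⟩
  have hκ0 : 0 < κ := by rw [hκ]; positivity
  have hκ1 : κ ≤ 1 / 4 := by
    have := min_le_right α 1
    linarith
  have hκα : 4 * κ ≤ α := by
    have := min_le_left α 1
    linarith
  obtain ⟨δ, hδ⟩ : ∃ δ, δ = κ / 2 / (4 * (2 + κ / 2)) := ⟨_, rfl⟩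
  have hδ0 : 0 < δ := by rw [hδ]; positivity
  have hδ1 : δ ≤ 1 := by
    rw [hδ, div_le_one (by positivity)]
    linarith
  obtain ⟨A, hA, hdec⟩ := exists_pow_le_rpow_neg (ρ := 1 - δ / 18) (by linarith) (by linarith)
    (lam + 4)
  have hb : 0 < κ / 2 * Real.log 2 := mul_pos (by linarith) (Real.log_pos one_lt_two)
  -- The bound for crowded internal vertices decays exponentially in `n`. One extra power of `n`
  -- pays for the union over `3 * k ≤ 3 * (A + 1) * n` rounds.
  have hlim := (tendsto_rpow_mul_exp_neg_mul_atTop_nhds_zero (lam + 1) _ hb).comp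
    tendsto_natCast_atTop_atTop
  have hev := hlim.eventually (gt_mem_nhds
    (show 0 < 1 / (6 * (A + 1) * Real.exp (12 * β)) by positivity))
  obtain ⟨n₁, hn₁⟩ := Filter.eventually_atTop.1 hev
  refine ⟨3 * (A + 1), by positivity,
    max (max 8 n₁) (max ⌈32 / δ⌉₊ ⌈2 * (5 + 4 * β)⌉₊), fun n hn T s hs m hm1 hm2 Ω _ μ _ X h => ?_⟩
  simp only [max_le_iff] at hn
  obtain ⟨⟨hn8, hnn₁⟩, hnδ, hnβ⟩ := hn
  have hn8' : (8 : ℝ) ≤ n := by exact_mod_cast hn8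
  have hn0 : (0 : ℝ) < n := by linarith
  have hnδ : 32 / δ ≤ n := Nat.ceil_le.1 hnδ
  have hnβ : 2 * (5 + 4 * β) ≤ n := Nat.ceil_le.1 hnβ
  have hKn := T.half_le_card_leaves
  have hK0 : (0 : ℝ) < T.leaves.card := by linarith
  set k := ⌈A * Real.log n⌉₊ with hk
  have hkl : (k : ℝ) ≤ (A + 1) * Real.log n := natCeil_mul_log_le hA (by omega)
  have hkn : (k : ℝ) ≤ (A + 1) * n := hkl.trans (by
    gcongr
    exact (Real.log_le_sub_one_of_pos hn0).trans (by linarith))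
  have hp := hdec n (by omega) k (Nat.le_ceil _)
  have hKδ : 16 / (T.leaves.card : ℝ) ≤ δ := by
    rw [div_le_iff₀ hK0]
    rw [div_le_iff₀ hδ0] at hnδ
    nlinarith
  have hmb := meet_bound (T := T) (A := Fin m) (by omega) hs h hκ0 hκ1
    (by rw [Fintype.card_fin]; exact le_trans (by gcongr) hm1)
    (by rw [Fintype.card_fin]; exact hm2) (by linarith) hδ hKδ k
  refine one_sub_le_measureReal_firstFull (t := 3 * k)
    (I := fun ω => meetInformed s fun g t => X g t ω) ?_ (hmb.trans ?_)
  · push_cast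
    linarith
  have hsplit : (n : ℝ) ^ (-lam) = (n : ℝ) ^ (-lam) / 2 + (n : ℝ) ^ (-lam) / 2 := by ring
  rw [hsplit]
  refine add_le_add ?_ ?_
  · have h1 := (hn₁ n hnn₁).le
    simp only [Function.comp_apply] at h1
    have h2 : (2 : ℝ) ^ (-(κ * n / 2)) = Real.exp (-(κ / 2 * Real.log 2) * n) := by
      rw [Real.rpow_def_of_pos two_pos]
      congr 1
      ring
    rw [le_div_iff₀ (by positivity)] at h1
    rw [h2]
    have h3 : (n : ℝ) ^ (lam + 1) = (n : ℝ) ^ lam * n := by rw [Real.rpow_add hn0, Real.rpow_one]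
    rw [h3] at h1
    rw [Real.rpow_neg hn0.le, ← one_div, div_div, le_div_iff₀ (by positivity)]
    calc _ ≤ 3 * ((A + 1) * n) *
          (Real.exp (12 * β) * Real.exp (-(κ / 2 * Real.log 2) * n)) * ((n : ℝ) ^ lam * 2) := by
          gcongr
      _ = (n : ℝ) ^ lam * n * Real.exp (-(κ / 2 * Real.log 2) * n) *
          (6 * (A + 1) * Real.exp (12 * β)) := by ring
      _ ≤ 1 := h1
  · calc (5 + 4 * β) * (n : ℝ) ^ 2 * (1 - δ / 18) ^ k
        ≤ n / 2 * (n : ℝ) ^ 2 * (n : ℝ) ^ (-(lam + 4)) := by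
          refine mul_le_mul ?_ hp (pow_nonneg (by linarith) k) (by positivity)
          gcongr
          linarith
      _ = (n : ℝ) ^ (3 : ℝ) * (n : ℝ) ^ (-(lam + 4)) / 2 := by
          rw [show (3 : ℝ) = (3 : ℕ) by norm_num, Real.rpow_natCast]
          ring
      _ = (n : ℝ) ^ (-(lam + 1)) / 2 := by
          rw [← Real.rpow_add hn0]
          congr 2
          ring
      _ ≤ _ := by
          gcongr
          · linarith
          · linarith

end RumorSpreading

theorem mainTheorem7 :
    -- push is logarithmic with high probability, for every source
    (∀ lam : ℝ, 0 < lam → ∃ C : ℝ, 0 < C ∧ ∃ n₀ : ℕ, ∀ n : ℕ, n₀ ≤ n →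
      ∀ (T : BalancedBinaryTree n) (s : Fin n)
        (Ω : Type*) [MeasurableSpace Ω] (μ : Measure Ω) [IsProbabilityMeasure μ]
        (N : ℕ → Fin n → Ω → Fin n), IsNeighborSampling T.heavyGraph μ N →
        1 - (n : ℝ) ^ (-lam) ≤
          μ.real {ω | (Tpush s (fun t u => N t u ω) : ℝ≥0∞) ≤ ENNReal.ofReal (C * Real.log n)}) ∧
    -- visit-exchange with linearly many agents takes linear time in expectation, for every source
    (∀ α β : ℝ, 0 < α → α ≤ β → ∃ c : ℝ, 0 < c ∧ ∃ n₀ : ℕ, ∀ n : ℕ, n₀ ≤ n →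
      ∀ (T : BalancedBinaryTree n) (s : Fin n)
        (m : ℕ), α * n ≤ m → (m : ℝ) ≤ β * n →
      ∀ (Ω : Type*) [MeasurableSpace Ω] (μ : Measure Ω) [IsProbabilityMeasure μ]
        (X : Fin m → ℕ → Ω → Fin n), IsStationaryWalks T.heavyGraph μ X →
        ENNReal.ofReal (c * n) ≤ ∫⁻ ω, (Tvisitx s (fun g t => X g t ω) : ℝ≥0∞) ∂μ) ∧
    -- meet-exchange with linearly many agents is logarithmic with high probability, from a leaf
    (∀ α β : ℝ, 0 < α → α ≤ β → ∀ lam : ℝ, 0 < lam →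
      ∃ C : ℝ, 0 < C ∧ ∃ n₀ : ℕ, ∀ n : ℕ, n₀ ≤ n →
      ∀ (T : BalancedBinaryTree n) (s : Fin n), T.IsLeaf s →
      ∀ (m : ℕ), α * n ≤ m → (m : ℝ) ≤ β * n →
      ∀ (Ω : Type*) [MeasurableSpace Ω] (μ : Measure Ω) [IsProbabilityMeasure μ]
        (X : Fin m → ℕ → Ω → Fin n), IsStationaryWalks T.heavyGraph μ X →
        1 - (n : ℝ) ^ (-lam) ≤
          μ.real {ω | (Tmeetx s (fun g t => X g t ω) : ℝ≥0∞) ≤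
            ENNReal.ofReal (C * Real.log n)}) := by
  exact ⟨fun lam _ => push_logarithmic lam, visitx_linear,
    fun α β hα hαβ lam _ => meetx_logarithmic α β hα hαβ lam⟩
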